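/- Fix infinite sets of variables and of data values, and a set $\mathcal S$ (a schema) of relation symbols, each with a fixed arity in $\{0,1,2,\dots\}$. A conjunctive query (CQ) $Q$ over $\mathcal S$ consists of a finite nonempty set $\mathrm{body}(Q)$ of atoms $R(x_1,\dots,x_r)$ over variables with $R\in\mathcal S$, and an atom $\mathrm{head}(Q)$ whose relation symbol is not in $\mathcal S$ and whose variables all occur in $\mathrm{body}(Q)$. For a set $D$ of facts (atoms over data values), $Q(D)=\{\nu(\mathrm{head}(Q)) : \nu \text{ a valuation of the variables with } \nu(\mathrm{body}(Q))\subseteq D\}$. A database over $\mathcal S$ is a finite set of facts with relation symbols in $\mathcal S$. A join tree for a set of atoms is a tree whose vertices are these atoms such that, whenever two atoms $A,A'$ share a variable $x$, every atom on the path from $A$ to $A'$ contains $x$. The query $Q$ is acyclic if $\mathrm{body}(Q)$ has a join tree; it is free-connex acyclic if, in addition, $\mathrm{body}(Q)\cup\{\mathrm{head}(Q)\}$ has a join tree. Let $\mathcal V$ be a set of views, that is, of CQs over $\mathcal S$, with pairwise different head relation symbols; let $\mathcal S_{\mathcal V}$ be the set of these symbols and $\mathcal V(D)=\bigcup_{V\in\mathcal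 V}V(D)$. A $\mathcal V$-rewriting of a CQ $Q$ over $\mathcal S$ is a CQ $Q'$ over $\mathcal S_{\mathcal V}$ such that $Q'(\mathcal V(D))=Q(D)$ for every database $D$ over $\mathcal S$. Theorem. Let $Q$ be a CQ over $\mathcal S$ and $\mathcal V$ a set of views over $\mathcal S$ as above, and suppose that $Q$ has a $\mathcal V$-rewriting. (1) If $Q$ is acyclic, then $Q$ has an acyclic $\mathcal V$-rewriting. (2) If $Q$ is free-connex acyclic, then $Q$ has a free-connex acyclic $\mathcal V$-rewriting. -/

import Mathlib

/-- An atom `r(x₁, …, xₖ)` with entries in `X`: a relation symbol `r` and as many entries as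
the arity `ar r` of `r` demands. The symbols form a type `R` and `ar` is their arity function.
For variables as entries these are the atoms of queries, for data values they are facts. -/
@[ext] structure RelAtom {R : Type*} (ar : R → ℕ) (X : Type*) where
  rel : R
  args : Fin (ar rel) → X

namespace RelAtom

variable {R X Y : Type*} {ar : R → ℕ}

/-- The set of entries of an atom. -/
def vars (A : RelAtom ar X) : Set X := Set.range A.args

/-- The atom `f(A) = r(f(x₁), …, f(xₖ))` for `A = r(x₁, …, xₖ)`. -/
def map (f : X → Y) (A : RelAtom ar X) : RelAtom ar Y := ⟨A.rel, fun i => f (A.args i)⟩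

end RelAtom

/-- `T` is a join tree for the set `𝒜` of atoms: a tree whose vertices are the atoms in `𝒜`
such that, whenever `A` and `A'` share a variable `x`, all atoms on the path of `T` from `A` to
`A'` contain `x`. -/
def IsJoinTree {R X : Type*} {ar : R → ℕ} (𝒜 : Set (RelAtom ar X)) (T : SimpleGraph 𝒜) : Prop :=
  T.IsTree ∧
    ∀ (A A' : 𝒜) (x : X), x ∈ A.1.vars → x ∈ A'.1.vars →
      ∀ p : T.Walk A A', p.IsPath → ∀ B ∈ p.support, x ∈ B.1.vars

/-- A (finite) database over the schema `S`, with data values in `Dom`. -/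
def IsDatabase {R Dom : Type*} {ar : R → ℕ} (S : Set R) (D : Set (RelAtom ar Dom)) : Prop :=
  D.Finite ∧ ∀ F ∈ D, F.rel ∈ S

/-- A conjunctive query `head ← body` over the schema `S`: the body is a finite nonempty set of
`S`-atoms, the symbol of the head is not in `S`, and the query is safe, that is, every head
variable occurs in the body. -/
structure ConjQuery {R : Type*} (ar : R → ℕ) (S : Set R) (Var : Type*) where
  head : RelAtom ar Var
  body : Finset (RelAtom ar Var)
  body_nonempty : body.Nonempty
  body_rel : ∀ A ∈ body, A.rel ∈ S
  head_rel : head.rel ∉ S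
  safe : ∀ x ∈ head.vars, ∃ A ∈ body, x ∈ A.vars

namespace ConjQuery

variable {R Var Dom : Type*} {ar : R → ℕ} {S : Set R}

/-- The result `Q(D)`: all facts `ν(head)` for valuations `ν` with `ν(body) ⊆ D`. -/
def eval (Q : ConjQuery ar S Var) (D : Set (RelAtom ar Dom)) : Set (RelAtom ar Dom) :=
  {F | ∃ ν : Var → Dom, (∀ A ∈ Q.body, A.map ν ∈ D) ∧ F = Q.head.map ν}

/-- A query is acyclic if (the set of atoms of) its body has a join tree. -/
def Acyclic (Q : ConjQuery ar S Var) : Prop :=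
  ∃ T : SimpleGraph {A | A ∈ Q.body}, IsJoinTree {A | A ∈ Q.body} T

/-- A query is free-connex acyclic if it is acyclic and the set of atoms that consists of its
body atoms and its head has a join tree, too. -/
def FreeConnexAcyclic (Q : ConjQuery ar S Var) : Prop :=
  Q.Acyclic ∧
    ∃ T : SimpleGraph {A | A ∈ Q.body ∨ A = Q.head}, IsJoinTree {A | A ∈ Q.body ∨ A = Q.head} T

/-- The schema of a set of views: the relation symbols of the heads of the views. -/
def viewSchema (𝒱 : Set (ConjQuery ar S Var)) : Set R := {r | ∃ V ∈ 𝒱, V.head.rel = r}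

/-- The `𝒱`-defined database `𝒱(D)`, the union of all `V(D)` with `V ∈ 𝒱`. -/
def viewDatabase (𝒱 : Set (ConjQuery ar S Var)) (D : Set (RelAtom ar Dom)) :
    Set (RelAtom ar Dom) :=
  {F | ∃ V ∈ 𝒱, F ∈ V.eval D}

/-- `Q'`, a query over the schema of `𝒱`, is a `𝒱`-rewriting of `Q` if `Q'(𝒱(D)) = Q(D)` for
every database `D` over `S` with data values in `Dom`. -/
def IsRewriting (Dom : Type*) (𝒱 : Set (ConjQuery ar S Var)) (Q : ConjQuery ar S Var)
    (Q' : ConjQuery ar (viewSchema 𝒱) Var) : Prop :=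
  ∀ D : Set (RelAtom ar Dom), IsDatabase S D → Q'.eval (viewDatabase 𝒱 D) = Q.eval D

end ConjQuery

/-! Let Q' be a rewriting. Evaluating Q' on the body of Q, read as a database, yields for each atom
of Q' an application (V, μ) of a view with μ(body V) ⊆ body(Q). Expanding these applications, with
fresh values for non-head variables, gives a database on which Q' returns the head of Q. So Q
returns it too, by a homomorphism h into the expansion that fixes the head variables
(`IsRewriting.exists_hom`). Collapsing the expansion turns h into an endomorphism of Q; after
replacing Q by its core (`exists_core`), h is injective. Thus h sends a variable of Q either to a
value visible in view heads or to a private value of one application.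

The applications need not form an acyclic query, because one of them may serve distant parts of a
join tree of Q. So each tree node is labelled with an application that covers the h-image of its
atom, adjacent nodes with equal labels are merged, and each component receives its own copy of the
head of its application (`IsIndexedDecomposition.exists_rewriting`). In that copy a value
representing a variable x of the component is renamed x, and all other values become fresh. A
variable with a private value occurs only in nodes with one label, and these are connected, so it
lives in a single component; hence valuations of the copies glue to a valuation of Q. Collapsing the
copies gives the converse inclusion. The contracted tree, with visible variables as bags and the
copies attached as leaves, witnesses acyclicity.

Passing to the core may delete atoms of the join tree, so the argument uses trees whose bags are
only subsets of atoms; `RunningIntersection.earDecomposable` leads back to join trees. In the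
free-connex case the tree has an unmerged top part whose bags together make up the head variables,
and this part can be replaced by the head. -/

section Acyclicity

/-! ### Running intersections, ears and join trees -/

/-- The running intersection property of a list of elements with attached sets, read from the
right: what an element shares with the elements to its right it shares with a single one. -/
def RunningIntersection {α X : Type*} (f : α → Set X) : List α → Prop
  | [] => True
  | a :: l => RunningIntersection f l ∧ (l = [] ∨ ∃ b ∈ l, ∀ c ∈ l, f a ∩ f c ⊆ f b)

/-- The nonempty finite sets that are obtained from singletons by adding ears. -/
inductive EarDecomposable {α X : Type*} [DecidableEq α] (f : α → Set X) : Finset α → Prop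
  | single (a : α) : EarDecomposable f {a}
  | ear {s : Finset α} (a b : α) (ha : a ∉ s) (hb : b ∈ s)
      (h : ∀ c ∈ s, f a ∩ f c ⊆ f b) (hs : EarDecomposable f s) : EarDecomposable f (insert a s)

theorem RunningIntersection.map {α β X : Type*} {f : α → Set X} {g : β → Set X} {φ : α → β} :
    ∀ {l : List α}, (∀ a ∈ l, g (φ a) = f a) → RunningIntersection f l →
      RunningIntersection g (l.map φ)
  | [], _, _ => trivial
  | a :: l, h, ⟨hl, hw⟩ => by
    refine ⟨hl.map fun b hb => h b (List.mem_cons_of_mem _ hb), ?_⟩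
    rcases hw with rfl | ⟨b, hb, hbc⟩
    · exact Or.inl rfl
    · refine Or.inr ⟨φ b, List.mem_map_of_mem hb, fun c hc => ?_⟩
      obtain ⟨d, hd, rfl⟩ := List.mem_map.1 hc
      rw [h a List.mem_cons_self, h d (List.mem_cons_of_mem _ hd),
        h b (List.mem_cons_of_mem _ hb)]
      exact hbc d hd

/-- The running intersection property is inherited by intersections with a fixed set. -/
theorem RunningIntersection.inter {α X : Type*} {f : α → Set X} (H : Set X) :
    ∀ {l : List α}, RunningIntersection f l → RunningIntersection (fun a => f a ∩ H) l
  | [], _ => trivial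
  | a :: l, ⟨hl, hw⟩ => by
    refine ⟨hl.inter H, ?_⟩
    rcases hw with rfl | ⟨b, hb, hbc⟩
    · exact Or.inl rfl
    · exact Or.inr ⟨b, hb, fun c hc x hx => ⟨hbc c hc ⟨hx.1.1, hx.2.1⟩, hx.1.2⟩⟩

theorem RunningIntersection.image {X Y : Type*} {φ : X → Y} {l : List (Set X)} {s : Set X}
    (hφ : Set.InjOn φ s) (hs : ∀ a ∈ l, a ⊆ s) (hl : RunningIntersection id l) :
    RunningIntersection id (l.map (φ '' ·)) := by
  induction l with
  | nil => trivial
  | cons a l ih =>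
    obtain ⟨hl, hw⟩ := hl
    refine ⟨ih (fun b hb => hs b (List.mem_cons_of_mem _ hb)) hl, ?_⟩
    rcases hw with rfl | ⟨b, hb, hbc⟩
    · exact Or.inl rfl
    · refine Or.inr ⟨φ '' b, List.mem_map_of_mem hb, fun c hc => ?_⟩
      obtain ⟨d, hd, rfl⟩ := List.mem_map.1 hc
      have := hφ.image_inter (hs a List.mem_cons_self) (hs d (List.mem_cons_of_mem _ hd))
      simp only [id] at hbc ⊢
      rw [← this]
      exact Set.image_mono (hbc d hd)

/-- The final part of a list may be replaced by the union of its sets. -/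
theorem RunningIntersection.append_singleton {X : Type*} {U : List (Set X)} {H : Set X}
    (hU : ∀ x, x ∈ H ↔ ∃ u ∈ U, x ∈ u) :
    ∀ {l : List (Set X)}, RunningIntersection id (l ++ U) → RunningIntersection id (l ++ [H])
  | [], _ => ⟨trivial, Or.inl rfl⟩
  | a :: l, ⟨hl, hw⟩ => by
    refine ⟨hl.append_singleton hU, Or.inr ?_⟩
    rcases hw with hw | ⟨b, hb, hbc⟩
    · obtain ⟨rfl, rfl⟩ := List.append_eq_nil_iff.1 hw
      refine ⟨H, by simp, ?_⟩
      simp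
    · have key : ∀ c ∈ l ++ [H], a ∩ c ⊆ b := by
        intro c hc x hx
        rcases List.mem_append.1 hc with hc | hc
        · exact hbc c (List.mem_append_left _ hc) hx
        · obtain rfl := List.mem_singleton.1 hc
          obtain ⟨u, hu, hxu⟩ := (hU x).1 hx.2
          exact hbc u (List.mem_append_right _ hu) ⟨hx.1, hxu⟩
      rcases List.mem_append.1 hb with hb | hb
      · exact ⟨b, List.mem_append_left _ hb, key⟩
      · refine ⟨H, by simp, fun c hc x hx => (hU x).2 ⟨b, hb, key c hc hx⟩⟩

/-- A member of a list with the running intersection property may be replaced by a larger set if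
the additional elements are new. -/
theorem RunningIntersection.replace {X : Type*} {F E : Set X} {l₂ : List (Set X)} (hFE : F ⊆ E) :
    ∀ {l₁ : List (Set X)}, (∀ c ∈ l₁ ++ F :: l₂, E ∩ c ⊆ F) →
      RunningIntersection id (l₁ ++ F :: l₂) → RunningIntersection id (l₁ ++ E :: l₂)
  | [], hE, ⟨hl, hw⟩ => by
    refine ⟨hl, hw.imp_right ?_⟩
    rintro ⟨b, hb, hbc⟩
    exact ⟨b, hb, fun c hc x hx => hbc c hc ⟨hE c (by simp [hc]) hx, hx.2⟩⟩
  | G :: l₁, hE, ⟨hl, hw⟩ => by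
    refine ⟨hl.replace hFE fun c hc => hE c (List.mem_cons_of_mem _ hc), Or.inr ?_⟩
    rcases hw with hw | ⟨b, hb, hbc⟩
    · simp at hw
    · have key : ∀ c ∈ l₁ ++ E :: l₂, G ∩ c ⊆ b := by
        intro c hc x hx
        have hc' : c ∈ l₁ ++ F :: l₂ ∨ c = E := by
          simp only [List.mem_append, List.mem_cons] at hc ⊢
          tauto
        rcases hc' with hc | rfl
        · exact hbc c hc hx
        · exact hbc F (by simp) ⟨hx.1, hE G (by simp) ⟨hx.2, hx.1⟩⟩
      have hb' : b ∈ l₁ ++ E :: l₂ ∨ b = F := by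
        change b ∈ l₁ ++ F :: l₂ at hb
        simp only [List.mem_append, List.mem_cons] at hb ⊢
        tauto
      rcases hb' with hb | rfl
      · exact ⟨b, hb, key⟩
      · exact ⟨E, by simp, fun c hc => (key c hc).trans hFE⟩

/-- A set of atoms is acyclic if there is a list of sets with the running intersection property
such that each of these sets is contained in an atom and each atom is contained in one of them. -/
theorem RunningIntersection.earDecomposable {α X : Type*} [DecidableEq α] {f : α → Set X} (n : ℕ) :
    ∀ {l : List (Set X)} {s : Finset α}, l.length + s.card ≤ n → s.Nonempty →
      RunningIntersection id l → (∀ b ∈ l, ∃ a ∈ s, b ⊆ f a) → (∀ a ∈ s, ∃ b ∈ l, f a ⊆ b) →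
      EarDecomposable f s := by
  induction n with
  | zero =>
    intro l s hn hs
    have := hs.card_pos
    omega
  | succ n ih =>
    intro l s hn hs hl h₁ h₂
    match l, hl with
    | [], _ =>
      obtain ⟨a, ha⟩ := hs
      obtain ⟨b, hb, -⟩ := h₂ a ha
      simp at hb
    | E :: l, ⟨hl, hw⟩ =>
      simp only [List.length_cons] at hn
      -- A set inside a later one is redundant. If E is in no later set, the atom `a` above it
      -- equals E, and any other atom inside E is an ear at `a`.
      by_cases hE : ∃ G ∈ l, E ⊆ G
      · obtain ⟨G, hG, hEG⟩ := hE
        refine ih (by omega) hs hl (fun b hb => h₁ b (List.mem_cons_of_mem _ hb)) fun a ha => ?_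
        obtain ⟨b, hb, hab⟩ := h₂ a ha
        rcases List.mem_cons.1 hb with rfl | hb
        · exact ⟨G, hG, hab.trans hEG⟩
        · exact ⟨b, hb, hab⟩
      obtain ⟨a, ha, hEa⟩ := h₁ E List.mem_cons_self
      have haE : f a = E := by
        obtain ⟨b, hb, hab⟩ := h₂ a ha
        rcases List.mem_cons.1 hb with rfl | hb
        · exact hab.antisymm hEa
        · exact (hE ⟨b, hb, hEa.trans hab⟩).elim
      by_cases hA : ∃ a' ∈ s, a' ≠ a ∧ f a' ⊆ E
      · obtain ⟨a', ha', hne, ha'E⟩ := hA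
        have ha'' : a ∈ s.erase a' := Finset.mem_erase.2 ⟨hne.symm, ha⟩
        have hc := Finset.card_erase_of_mem ha'
        have hpos := hs.card_pos
        rw [← Finset.insert_erase ha']
        refine .ear a' a (Finset.notMem_erase _ _) ha'' ?_ (ih (l := E :: l) ?_ ⟨a, ha''⟩ ⟨hl, hw⟩
          ?_ fun c hc => h₂ c (Finset.mem_of_mem_erase hc))
        · intro c _ x hx
          rw [haE]
          exact ha'E hx.1
        · simp only [List.length_cons]
          omega
        · intro b hb
          obtain ⟨c, hcs, hbc⟩ := h₁ b hb
          by_cases hca : c = a'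
          · subst hca
            exact ⟨a, ha'', haE ▸ hbc.trans ha'E⟩
          · exact ⟨c, Finset.mem_erase.2 ⟨hca, hcs⟩, hbc⟩
      · push Not at hA
        by_cases hsa : s = {a}
        · exact hsa ▸ .single a
        have hl' : ∀ c ∈ s, c ≠ a → ∃ b ∈ l, f c ⊆ b := by
          intro c hc hca
          obtain ⟨b, hb, hcb⟩ := h₂ c hc
          rcases List.mem_cons.1 hb with rfl | hb
          · exact (hA c hc hca hcb).elim
          · exact ⟨b, hb, hcb⟩
        obtain ⟨c₀, hc₀, hc₀a⟩ : ∃ c ∈ s, c ≠ a := by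
          by_contra! h
          exact hsa (Finset.eq_singleton_iff_unique_mem.2 ⟨ha, h⟩)
        rcases hw with rfl | ⟨F, hF, hFc⟩
        · obtain ⟨b, hb, -⟩ := hl' c₀ hc₀ hc₀a
          simp at hb
        simp only [id] at hFc
        -- If the witness F lies in E, then E moves to the place of F. Otherwise an atom `d` above F
        -- differs from `a`, and `a` is an ear at `d`.
        by_cases hFE : F ⊆ E
        · obtain ⟨l₁, l₂, rfl⟩ := List.append_of_mem hF
          refine ih ?_ hs (hl.replace hFE hFc) ?_ ?_
          · simp only [List.length_append, List.length_cons] at hn ⊢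
            omega
          · intro b hb
            refine h₁ b ?_
            simp only [List.mem_append, List.mem_cons] at hb ⊢
            tauto
          · intro c hc
            obtain ⟨b, hb, hcb⟩ := h₂ c hc
            by_cases hbF : b = F
            · exact ⟨E, by simp, hcb.trans (hbF ▸ hFE)⟩
            · refine ⟨b, ?_, hcb⟩
              simp only [List.mem_append, List.mem_cons] at hb ⊢
              tauto
        · obtain ⟨d, hd, hFd⟩ := h₁ F (List.mem_cons_of_mem _ hF)
          have hda : d ≠ a := by
            rintro rfl
            exact hFE (haE ▸ hFd)
          have hd' : d ∈ s.erase a := Finset.mem_erase.2 ⟨hda, hd⟩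
          have hc := Finset.card_erase_of_mem ha
          rw [← Finset.insert_erase ha]
          refine .ear a d (Finset.notMem_erase _ _) hd' ?_ (ih ?_ ⟨d, hd'⟩ hl ?_ ?_)
          · intro c hc x hx
            obtain ⟨b, hb, hcb⟩ := hl' c (Finset.mem_of_mem_erase hc) (Finset.ne_of_mem_erase hc)
            exact hFd (hFc b hb ⟨haE ▸ hx.1, hcb hx.2⟩)
          · omega
          · intro b hb
            obtain ⟨c, hcs, hbc⟩ := h₁ b (List.mem_cons_of_mem _ hb)
            by_cases hca : c = a
            · subst hca
              exact ⟨d, hd', fun x hx => hFd (hFc b hb ⟨haE ▸ hbc hx, hx⟩)⟩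
            · exact ⟨c, Finset.mem_erase.2 ⟨hca, hcs⟩, hbc⟩
          · intro c hc
            exact hl' c (Finset.mem_of_mem_erase hc) (Finset.ne_of_mem_erase hc)

/-- A set that is built by adding ears carries a tree in which the members that contain a given
element are connected. -/
theorem EarDecomposable.exists_graph {α X : Type*} [DecidableEq α] {f : α → Set X} {s : Finset α}
    (hs : EarDecomposable f s) :
    ∃ G : SimpleGraph α, (∀ u v, G.Adj u v → u ∈ s ∧ v ∈ s) ∧ G.IsAcyclic ∧
      (∀ u ∈ s, ∀ v ∈ s, ∃ p : G.Walk u v, ∀ w ∈ p.support, w ∈ s) ∧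
      ∀ x, ∀ u ∈ s, ∀ v ∈ s, x ∈ f u → x ∈ f v →
        ∃ p : G.Walk u v, ∀ w ∈ p.support, w ∈ s ∧ x ∈ f w := by
  induction hs with
  | single a =>
    refine ⟨⊥, fun u v h => h.elim, SimpleGraph.isAcyclic_bot, ?_, ?_⟩
    · intro u hu v hv
      obtain rfl := Finset.mem_singleton.1 hu
      obtain rfl := Finset.mem_singleton.1 hv
      exact ⟨.nil, by simp⟩
    · intro x u hu v hv hxu _
      obtain rfl := Finset.mem_singleton.1 hu
      obtain rfl := Finset.mem_singleton.1 hv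
      exact ⟨.nil, by simpa using hxu⟩
  | @ear s a b ha hb h _ ih =>
    obtain ⟨G, hG, hac, hcon, hx⟩ := ih
    have hab : a ≠ b := fun e => ha (e ▸ hb)
    have hle : G ≤ G ⊔ SimpleGraph.edge a b := le_sup_left
    have hadj : (G ⊔ SimpleGraph.edge a b).Adj a b := by
      simp [SimpleGraph.sup_adj, SimpleGraph.edge_adj, hab]
    have hreach : ¬ G.Reachable a b := by
      rintro ⟨p⟩
      cases p with
      | nil => exact hab rfl
      | cons h _ => exact ha (hG _ _ h).1
    -- Used twice: with P trivial for connectedness, and with P saying that x is contained in the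
    -- member.
    have hconn : ∀ (P : α → Prop), (∀ u ∈ s, ∀ v ∈ s, P u → P v →
          ∃ p : G.Walk u v, ∀ w ∈ p.support, w ∈ s ∧ P w) →
        (∀ c ∈ s, P a → P c → P b) → ∀ u ∈ insert a s, ∀ v ∈ insert a s, P u → P v →
          ∃ p : (G ⊔ SimpleGraph.edge a b).Walk u v, ∀ w ∈ p.support, w ∈ insert a s ∧ P w := by
      intro P hP hPb u hu v hv hPu hPv
      rcases Finset.mem_insert.1 hu with rfl | hu' <;> rcases Finset.mem_insert.1 hv with rfl | hv'
      · exact ⟨.nil, by simp [hPu]⟩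
      · obtain ⟨p, hp⟩ := hP b hb v hv' (hPb v hv' hPu hPv) hPv
        refine ⟨.cons hadj (p.mapLe hle), ?_⟩
        intro w hw
        rw [SimpleGraph.Walk.support_cons, SimpleGraph.Walk.support_mapLe_eq_support] at hw
        rcases List.mem_cons.1 hw with rfl | hw
        · exact ⟨hu, hPu⟩
        · exact ⟨Finset.mem_insert_of_mem (hp w hw).1, (hp w hw).2⟩
      · obtain ⟨p, hp⟩ := hP b hb u hu' (hPb u hu' hPv hPu) hPu
        refine ⟨(SimpleGraph.Walk.cons hadj (p.mapLe hle)).reverse, ?_⟩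
        intro w hw
        rw [SimpleGraph.Walk.support_reverse, List.mem_reverse, SimpleGraph.Walk.support_cons,
          SimpleGraph.Walk.support_mapLe_eq_support] at hw
        rcases List.mem_cons.1 hw with rfl | hw
        · exact ⟨hv, hPv⟩
        · exact ⟨Finset.mem_insert_of_mem (hp w hw).1, (hp w hw).2⟩
      · obtain ⟨p, hp⟩ := hP u hu' v hv' hPu hPv
        refine ⟨p.mapLe hle, fun w hw => ?_⟩
        rw [SimpleGraph.Walk.support_mapLe_eq_support] at hw
        exact ⟨Finset.mem_insert_of_mem (hp w hw).1, (hp w hw).2⟩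
    refine ⟨G ⊔ SimpleGraph.edge a b, ?_, hac.sup_edge_of_not_reachable hreach, ?_, ?_⟩
    · intro u v huv
      rw [SimpleGraph.sup_adj, SimpleGraph.edge_adj] at huv
      rcases huv with huv | ⟨⟨rfl, rfl⟩ | ⟨rfl, rfl⟩, -⟩
      · exact ⟨Finset.mem_insert_of_mem (hG u v huv).1, Finset.mem_insert_of_mem (hG u v huv).2⟩
      · exact ⟨Finset.mem_insert_self _ _, Finset.mem_insert_of_mem hb⟩
      · exact ⟨Finset.mem_insert_of_mem hb, Finset.mem_insert_self _ _⟩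
    · intro u hu v hv
      obtain ⟨p, hp⟩ := hconn (fun _ => True) (by simpa using hcon) (by simp) u hu v hv trivial
        trivial
      exact ⟨p, fun w hw => (hp w hw).1⟩
    · intro x
      exact hconn (fun w => x ∈ f w) (hx x) fun c hc hxa hxc => h c hc ⟨hxa, hxc⟩

/-- Paths in a tree are unique, so a walk through members containing x already bounds the path of
the join tree. -/
theorem EarDecomposable.exists_isJoinTree {R X : Type*} {ar : R → ℕ}
    [DecidableEq (RelAtom ar X)] {s : Finset (RelAtom ar X)} (hs : EarDecomposable RelAtom.vars s)
    {𝒜 : Set (RelAtom ar X)} (h𝒜 : ∀ A, A ∈ 𝒜 ↔ A ∈ s) :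
    ∃ T : SimpleGraph 𝒜, IsJoinTree 𝒜 T := by
  obtain ⟨G, -, hac, hcon, hx⟩ := hs.exists_graph
  obtain ⟨A₀, hA₀⟩ : s.Nonempty := by cases hs <;> simp
  have hT : (G.induce 𝒜).IsTree := by
    have : Nonempty 𝒜 := ⟨A₀, (h𝒜 A₀).2 hA₀⟩
    refine ⟨⟨fun A A' => ?_⟩, hac.induce 𝒜⟩
    obtain ⟨p, hp⟩ := hcon A.1 ((h𝒜 _).1 A.2) A'.1 ((h𝒜 _).1 A'.2)
    exact ⟨p.induce 𝒜 fun w hw => (h𝒜 w).2 (hp w hw)⟩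
  refine ⟨G.induce 𝒜, hT, fun A A' x hxA hxA' p hp B hB => ?_⟩
  obtain ⟨q, hq⟩ := hx x A.1 ((h𝒜 _).1 A.2) A'.1 ((h𝒜 _).1 A'.2) hxA hxA'
  have hq𝒜 : ∀ w ∈ q.support, w ∈ 𝒜 := fun w hw => (h𝒜 w).2 (hq w hw).1
  have hpq := (hT.existsUnique_path A A').unique hp (q.induce 𝒜 hq𝒜).bypass_isPath
  rw [hpq] at hB
  have hB' := SimpleGraph.Walk.support_bypass_subset_support _ hB
  rw [SimpleGraph.Walk.support_induce] at hB'
  simp only [List.mem_attachWith] at hB'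
  exact (hq B.1 hB').2

/-- The atoms of a join tree, ordered by their distance from a root. -/
theorem IsJoinTree.exists_list {R X : Type*} {ar : R → ℕ} {𝒜 : Set (RelAtom ar X)}
    (h𝒜 : 𝒜.Finite) {T : SimpleGraph 𝒜} (hT : IsJoinTree 𝒜 T) (ρ : 𝒜) :
    ∃ l : List (RelAtom ar X), RunningIntersection RelAtom.vars (l ++ [ρ.1]) ∧ ρ.1 ∉ l ∧
      ∀ A, A ∈ l ++ [ρ.1] ↔ A ∈ 𝒜 := by
  classical
  have hc := hT.1.1
  -- P is the neighbour of A on a shortest path to ρ. A shortest walk from ρ to B avoids A, so going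
  -- from A via P and ρ to B can be shortened to a path that still starts with the edge from A to P.
  have parent : ∀ A : 𝒜, A ≠ ρ → ∃ P : 𝒜, T.dist ρ P < T.dist ρ A ∧
      ∀ B : 𝒜, B ≠ A → T.dist ρ B ≤ T.dist ρ A → A.1.vars ∩ B.1.vars ⊆ P.1.vars := by
    intro A hA
    obtain ⟨p, hp, hpl⟩ := hc.exists_path_of_dist A ρ
    cases p with
    | nil => exact (hA rfl).elim
    | @cons _ P _ hAP q =>
      rw [SimpleGraph.Walk.cons_isPath_iff] at hp
      refine ⟨P, ?_, fun B hBA hBd x hx => ?_⟩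
      · rw [T.dist_comm (u := ρ) (v := A), ← hpl, SimpleGraph.Walk.length_cons, T.dist_comm]
        exact Nat.lt_succ_of_le (T.dist_le q)
      · obtain ⟨r, hr⟩ := hc.exists_walk_length_eq_dist ρ B
        have hAr : A ∉ r.support := by
          intro h
          have h1 := T.dist_le (r.takeUntil A h)
          have h2 := congrArg SimpleGraph.Walk.length (r.take_spec h)
          rw [SimpleGraph.Walk.length_append] at h2
          have h3 : (r.dropUntil A h).length = 0 := by omega
          exact hBA (SimpleGraph.Walk.eq_of_length_eq_zero h3).symm
        have hAw : A ∉ (q.append r).bypass.support := by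
          intro h
          have := SimpleGraph.Walk.support_bypass_subset_support _ h
          rw [SimpleGraph.Walk.mem_support_append_iff] at this
          exact this.elim hp.2 hAr
        exact hT.2 A B x hx.1 hx.2 _
          ((SimpleGraph.Walk.bypass_isPath (q.append r)).cons (h := hAP) hAw) P (by simp)
  have := h𝒜.fintype
  have main : ∀ s : Finset 𝒜, (∀ A ∈ s, A ≠ ρ) →
      (∀ A ∈ s, ∀ P : 𝒜, P ≠ ρ → T.dist ρ P < T.dist ρ A → P ∈ s) →
      ∃ l : List 𝒜, RunningIntersection (fun A : 𝒜 => A.1.vars) (l ++ [ρ]) ∧ ∀ A, A ∈ l ↔ A ∈ s := by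
    intro s
    induction s using Finset.induction_on_max_value (fun A => T.dist ρ A) with
    | empty => exact fun _ _ => ⟨[], ⟨trivial, Or.inl rfl⟩, by simp⟩
    | insert A s hAs hmax ih =>
      intro hρ hdown
      obtain ⟨l, hl, hmem⟩ := ih (fun B hB => hρ B (Finset.mem_insert_of_mem hB)) (by
        intro B hB P hP hlt
        rcases Finset.mem_insert.1 (hdown B (Finset.mem_insert_of_mem hB) P hP hlt) with rfl | h
        · exact absurd (hmax B hB) (not_le.2 hlt)
        · exact h)
      obtain ⟨P, hPd, hP⟩ := parent A (hρ A (Finset.mem_insert_self _ _))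
      refine ⟨A :: l, ⟨hl, Or.inr ⟨P, ?_, fun B hB => ?_⟩⟩, fun B => by simp [hmem]⟩
      · by_cases hPρ : P = ρ
        · simp [hPρ]
        · rcases Finset.mem_insert.1 (hdown A (Finset.mem_insert_self _ _) P hPρ hPd) with rfl | h
          · exact absurd hPd (lt_irrefl _)
          · exact List.mem_append_left _ ((hmem P).2 h)
      · rcases List.mem_append.1 hB with hB | hB
        · have hBs := (hmem B).1 hB
          exact hP B (fun e => hAs (e ▸ hBs)) (hmax B hBs)
        · obtain rfl := List.mem_singleton.1 hB
          exact hP B (hρ A (Finset.mem_insert_self _ _)).symm (by simp)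
  obtain ⟨l, hl, hmem⟩ := main (Finset.univ.erase ρ) (fun A hA => Finset.ne_of_mem_erase hA)
    (fun A _ P hP _ => Finset.mem_erase.2 ⟨hP, Finset.mem_univ _⟩)
  refine ⟨l.map Subtype.val, ?_, ?_, ?_⟩
  · have := hl.map (g := RelAtom.vars) (φ := Subtype.val) fun _ _ => rfl
    simpa using this
  · intro h
    obtain ⟨A, hA, hAρ⟩ := List.mem_map.1 h
    exact Finset.ne_of_mem_erase ((hmem A).1 hA) (Subtype.ext hAρ)
  · intro A
    simp only [List.mem_append, List.mem_map, List.mem_singleton]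
    constructor
    · rintro (⟨B, -, rfl⟩ | rfl)
      exacts [B.2, ρ.2]
    · intro hA
      by_cases h : (⟨A, hA⟩ : 𝒜) = ρ
      · exact Or.inr (congrArg Subtype.val h)
      · exact Or.inl ⟨⟨A, hA⟩, (hmem _).2 (Finset.mem_erase.2 ⟨h, Finset.mem_univ _⟩), rfl⟩

end Acyclicity

/-! ### Images of atoms -/

namespace RelAtom

variable {R X Y Z : Type*} {ar : R → ℕ}

theorem vars_map (f : X → Y) (A : RelAtom ar X) : (A.map f).vars = f '' A.vars :=
  Set.range_comp f A.args

theorem finite_vars (A : RelAtom ar X) : A.vars.Finite := Set.finite_range _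

theorem map_map (g : Y → Z) (f : X → Y) (A : RelAtom ar X) :
    (A.map f).map g = A.map fun x => g (f x) := rfl

theorem map_congr {f g : X → Y} {A : RelAtom ar X} (h : ∀ x ∈ A.vars, f x = g x) :
    A.map f = A.map g :=
  congrArg (RelAtom.mk A.rel) (funext fun i => h _ ⟨i, rfl⟩)

theorem map_eq_self {f : X → X} {A : RelAtom ar X} (h : ∀ x ∈ A.vars, f x = x) : A.map f = A :=
  (map_congr (g := id) h).trans rfl

theorem eq_of_map_eq_map {f g : X → Y} {A : RelAtom ar X} (h : A.map f = A.map g) :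
    ∀ x ∈ A.vars, f x = g x := by
  rintro _ ⟨i, rfl⟩
  have : (fun i => f (A.args i)) = fun i => g (A.args i) := by
    simpa [map] using h
  exact congrFun this i

/-- An equation between images of atoms can be checked entry by entry along another one. -/
theorem map_eq_map_of_map_eq_map {Z' : Type*} {A : RelAtom ar X} {B : RelAtom ar Y}
    {f : X → Z} {g : Y → Z} (h : A.map f = B.map g) {f' : X → Z'} {g' : Y → Z'}
    (h' : ∀ x ∈ A.vars, ∀ y ∈ B.vars, f x = g y → f' x = g' y) : A.map f' = B.map g' := by
  obtain ⟨r, a⟩ := A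
  obtain ⟨r', b⟩ := B
  obtain rfl : r = r' := congrArg RelAtom.rel h
  have h₁ : (fun i => f (a i)) = fun i => g (b i) := by
    simpa [map] using h
  exact congrArg (RelAtom.mk r) (funext fun i => h' _ ⟨i, rfl⟩ _ ⟨i, rfl⟩ (congrFun h₁ i))

theorem exists_of_map_eq_map {A : RelAtom ar X} {B : RelAtom ar Y} {f : X → Z} {g : Y → Z}
    (h : A.map f = B.map g) {x : X} (hx : x ∈ A.vars) : ∃ y ∈ B.vars, f x = g y := by
  have : f x ∈ (B.map g).vars := by
    rw [← h, vars_map]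
    exact ⟨x, hx, rfl⟩
  rw [vars_map] at this
  obtain ⟨y, hy, hyx⟩ := this
  exact ⟨y, hy, hyx.symm⟩

end RelAtom

/-! ### Evaluation, homomorphisms and change of the data domain -/

namespace ConjQuery

variable {R Var Var' Dom Dom' : Type*} {ar : R → ℕ} {S : Set R}

/-- The set of variables of a query. -/
def bodyVars (Q : ConjQuery ar S Var) : Set Var := {x | ∃ A ∈ Q.body, x ∈ A.vars}

theorem finite_bodyVars (Q : ConjQuery ar S Var) : Q.bodyVars.Finite := by
  have : Q.bodyVars = ⋃ A ∈ Q.body, A.vars := by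
    ext x
    simp [bodyVars]
  rw [this]
  exact Q.body.finite_toSet.biUnion fun A _ => A.finite_vars

theorem eval_mono (Q : ConjQuery ar S Var) {D D' : Set (RelAtom ar Dom)} (h : D ⊆ D') :
    Q.eval D ⊆ Q.eval D' := by
  rintro F ⟨ν, hν, rfl⟩
  exact ⟨ν, fun A hA => h (hν A hA), rfl⟩

theorem map_mem_eval {Q : ConjQuery ar S Var} {D : Set (RelAtom ar Dom)} (f : Dom → Dom')
    {F : RelAtom ar Dom} (hF : F ∈ Q.eval D) : F.map f ∈ Q.eval (RelAtom.map f '' D) := by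
  obtain ⟨ν, hν, rfl⟩ := hF
  exact ⟨fun x => f (ν x), fun A hA => ⟨_, hν A hA, rfl⟩, rfl⟩

theorem image_viewDatabase_subset (𝒱 : Set (ConjQuery ar S Var)) (D : Set (RelAtom ar Dom))
    (f : Dom → Dom') :
    RelAtom.map f '' viewDatabase 𝒱 D ⊆ viewDatabase 𝒱 (RelAtom.map f '' D) := by
  rintro _ ⟨F, ⟨V, hV, hF⟩, rfl⟩
  exact ⟨V, hV, map_mem_eval f hF⟩

/-- Homomorphisms of queries reverse the inclusion of results. -/
theorem eval_subset_of_hom {Q : ConjQuery ar S Var} {Q' : ConjQuery ar S Var'} (f : Var → Var')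
    (hb : ∀ A ∈ Q.body, A.map f ∈ Q'.body) (hh : Q.head.map f = Q'.head)
    (D : Set (RelAtom ar Dom)) : Q'.eval D ⊆ Q.eval D := by
  rintro F ⟨ν, hν, rfl⟩
  exact ⟨fun x => ν (f x), fun A hA => hν _ (hb A hA), by rw [← hh]; rfl⟩

/-- The data values of a result occur in the database. -/
theorem exists_mem_vars_of_mem_eval {Q : ConjQuery ar S Var} {D : Set (RelAtom ar Dom)}
    {F : RelAtom ar Dom} (hF : F ∈ Q.eval D) {d : Dom} (hd : d ∈ F.vars) :
    ∃ G ∈ D, d ∈ G.vars := by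
  obtain ⟨ν, hν, rfl⟩ := hF
  rw [RelAtom.vars_map] at hd
  obtain ⟨x, hx, rfl⟩ := hd
  obtain ⟨A, hA, hxA⟩ := Q.safe x hx
  exact ⟨_, hν A hA, by rw [RelAtom.vars_map]; exact ⟨x, hxA, rfl⟩⟩

theorem _root_.Set.Finite.exists_injOn_of_infinite {X Y : Type*} [Infinite Y] {s : Set X}
    (hs : s.Finite) : ∃ f : X → Y, Set.InjOn f s := by
  obtain ⟨f, -, hf⟩ := hs.exists_injOn_of_encard_le (t := (Set.univ : Set Y)) (by simp)
  exact ⟨f, hf⟩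

/-- Rewritings do not depend on the set of data values. -/
theorem IsRewriting.change_domain [Infinite Dom] [Nonempty Dom'] {𝒱 : Set (ConjQuery ar S Var)}
    {Q : ConjQuery ar S Var} {Q' : ConjQuery ar (viewSchema 𝒱) Var}
    (h : IsRewriting Dom 𝒱 Q Q') : IsRewriting Dom' 𝒱 Q Q' := by
  intro D hD
  have hfin : {d | ∃ G ∈ D, d ∈ G.vars}.Finite := by
    have : {d | ∃ G ∈ D, d ∈ G.vars} = ⋃ G ∈ D, G.vars := by
      ext d
      simp
    rw [this]
    exact hD.1.biUnion fun G _ => G.finite_vars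
  obtain ⟨f, hf⟩ := hfin.exists_injOn_of_infinite (Y := Dom)
  have hinv := hf.leftInvOn_invFunOn
  set g := Function.invFunOn f {d | ∃ G ∈ D, d ∈ G.vars}
  have hD' : IsDatabase S (RelAtom.map f '' D) :=
    ⟨hD.1.image _, by rintro _ ⟨F, hF, rfl⟩; exact hD.2 F hF⟩
  have hback : RelAtom.map g '' (RelAtom.map f '' D) = D := by
    ext F
    constructor
    · rintro ⟨_, ⟨G, hG, rfl⟩, rfl⟩
      rw [RelAtom.map_map, RelAtom.map_eq_self fun x hx => hinv ⟨G, hG, hx⟩]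
      exact hG
    · intro hF
      exact ⟨_, ⟨F, hF, rfl⟩, RelAtom.map_eq_self fun x hx => hinv ⟨F, hF, hx⟩⟩
  -- Results move along f to the other domain, where `h'` applies, and return along g; all values
  -- involved come from D, where g inverts f.
  have h' := h _ hD'
  ext F
  constructor
  · intro hF
    have h₁ : F.map f ∈ Q'.eval (viewDatabase 𝒱 (RelAtom.map f '' D)) :=
      eval_mono Q' (image_viewDatabase_subset 𝒱 D f) (map_mem_eval f hF)
    rw [h'] at h₁
    have h₂ := map_mem_eval g h₁
    rw [hback, RelAtom.map_map, RelAtom.map_eq_self] at h₂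
    · exact h₂
    · intro x hx
      obtain ⟨G, ⟨V, hV, hG⟩, hxG⟩ := exists_mem_vars_of_mem_eval hF hx
      exact hinv (exists_mem_vars_of_mem_eval hG hxG)
  · intro hF
    have h₁ := map_mem_eval f hF
    rw [← h'] at h₁
    have h₂ := eval_mono Q' (image_viewDatabase_subset 𝒱 _ g) (map_mem_eval g h₁)
    rw [hback, RelAtom.map_map, RelAtom.map_eq_self] at h₂
    · exact h₂
    · intro x hx
      exact hinv (exists_mem_vars_of_mem_eval hF hx)

/-! ### Cores -/

/-- Every query has a core: an equivalent subquery, to which the query retracts, and all of whose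
endomorphisms that fix the head are injective. -/
theorem exists_core (Q : ConjQuery ar S Var) :
    ∃ Q₀ : ConjQuery ar S Var, Q₀.head = Q.head ∧ Q₀.body ⊆ Q.body ∧
      (∃ e : Var → Var, (∀ A ∈ Q.body, A.map e ∈ Q₀.body) ∧ ∀ x ∈ Q₀.bodyVars, e x = x) ∧
      ∀ e : Var → Var, (∀ A ∈ Q₀.body, A.map e ∈ Q₀.body) → (∀ x ∈ Q₀.head.vars, e x = x) →
        Set.InjOn e Q₀.bodyVars := by
  classical
  let P : Finset (RelAtom ar Var) → Prop := fun s => s ⊆ Q.body ∧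
    ∃ e : Var → Var, (∀ x ∈ Q.head.vars, e x = x) ∧ ∀ A ∈ Q.body, A.map e ∈ s
  obtain ⟨s, ⟨hsub, e, hhead, hbody⟩, hmin⟩ :
      ∃ s, P s ∧ ∀ t, P t → s.card ≤ t.card := by
    have hne : ({s | P s} : Set _).Nonempty :=
      ⟨Q.body, Finset.Subset.refl _, id, fun _ _ => rfl, fun A hA => hA⟩
    obtain ⟨s, hs, hmin⟩ :=
      WellFounded.has_min (measure (Finset.card (α := RelAtom ar Var))).wf _ hne
    exact ⟨s, hs, fun t ht => not_lt.1 (hmin t ht)⟩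
  -- The image of s under `e'` again admits a head-fixing map from Q, namely `e'` after `e`, so
  -- minimality of s excludes a proper image.
  have hendo : ∀ e' : Var → Var, (∀ A ∈ s, A.map e' ∈ s) → (∀ x ∈ Q.head.vars, e' x = x) →
      s.image (RelAtom.map e') = s := by
    intro e' he' hh'
    have hss : s.image (RelAtom.map e') ⊆ s := by
      intro A hA
      obtain ⟨B, hB, rfl⟩ := Finset.mem_image.1 hA
      exact he' B hB
    refine Finset.eq_of_subset_of_card_le hss (hmin _ ⟨hss.trans hsub, fun x => e' (e x), ?_, ?_⟩)
    · intro x hx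
      simp only [hhead x hx, hh' x hx]
    · intro A hA
      exact Finset.mem_image.2 ⟨_, hbody A hA, rfl⟩
  let Q₀ : ConjQuery ar S Var :=
    { head := Q.head
      body := s
      body_nonempty := Q.body_nonempty.elim fun A hA => ⟨_, hbody A hA⟩
      body_rel := fun A hA => Q.body_rel A (hsub hA)
      head_rel := Q.head_rel
      safe := fun x hx => by
        obtain ⟨A, hA, hxA⟩ := Q.safe x hx
        refine ⟨_, hbody A hA, ?_⟩
        rw [RelAtom.vars_map]
        exact ⟨x, hxA, hhead x hx⟩ }
  have hinj : ∀ e' : Var → Var, (∀ A ∈ s, A.map e' ∈ s) → (∀ x ∈ Q.head.vars, e' x = x) →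
      Set.InjOn e' Q₀.bodyVars := by
    intro e' he' hh'
    have hmaps : Set.MapsTo e' Q₀.bodyVars Q₀.bodyVars := by
      rintro x ⟨A, hA, hx⟩
      exact ⟨_, he' A hA, by rw [RelAtom.vars_map]; exact ⟨x, hx, rfl⟩⟩
    have hsurj : Set.SurjOn e' Q₀.bodyVars Q₀.bodyVars := by
      rintro x ⟨A, hA, hx⟩
      have hA' : A ∈ s.image (RelAtom.map e') := (hendo e' he' hh').symm ▸ hA
      obtain ⟨B, hB, rfl⟩ := Finset.mem_image.1 hA'
      rw [RelAtom.vars_map] at hx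
      obtain ⟨y, hy, rfl⟩ := hx
      exact ⟨y, ⟨B, hB, hy⟩, rfl⟩
    have hfin := Q₀.finite_bodyVars
    exact (Set.Finite.surjOn_iff_bijOn_of_mapsTo hfin hmaps).1 hsurj |>.injOn
  have hes : ∀ A ∈ s, A.map e ∈ s := fun A hA => hbody A (hsub hA)
  refine ⟨Q₀, rfl, hsub, ?_, hinj⟩
  have : Nonempty Var ∨ IsEmpty Var := (isEmpty_or_nonempty Var).symm
  rcases this with _ | _
  -- On the core, `e` is a bijection; composing with its inverse turns `e` into a retraction.
  · have hinv := (hinj e hes hhead).leftInvOn_invFunOn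
    refine ⟨fun x => Function.invFunOn e Q₀.bodyVars (e x), fun A hA => ?_, fun x hx => hinv hx⟩
    have hA' : A.map e ∈ s.image (RelAtom.map e) := (hendo e hes hhead).symm ▸ hbody A hA
    obtain ⟨B, hB, hBA⟩ := Finset.mem_image.1 hA'
    have : (A.map e).map (Function.invFunOn e Q₀.bodyVars) = B := by
      rw [← hBA, RelAtom.map_map]
      exact RelAtom.map_eq_self fun x hx => hinv ⟨B, hB, hx⟩
    rw [← RelAtom.map_map, this]
    exact hB
  · exact ⟨e, hbody, fun x => isEmptyElim x⟩

/-! ### Decompositions of queries -/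

/-- A join tree of a query in the form of a list of pairs of an atom and a set of some of its
variables. The roots `U` carry head variables only. -/
structure IsDecomposition (Q : ConjQuery ar S Var)
    (L U : List (Set Var × RelAtom ar Var)) : Prop where
  running : RunningIntersection Prod.fst (L ++ U)
  bag_subset : ∀ b ∈ L ++ U, b.1 ⊆ b.2.vars
  atom_mem : ∀ b ∈ L ++ U, b.2 ∈ Q.body
  mem_of_mem_body : ∀ A ∈ Q.body, (A.vars, A) ∈ L ++ U
  root_subset : ∀ b ∈ U, b.1 ⊆ Q.head.vars

theorem Acyclic.exists_isDecomposition {Q : ConjQuery ar S Var} (h : Q.Acyclic) :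
    ∃ L, Q.IsDecomposition L [] := by
  obtain ⟨T, hT⟩ := h
  obtain ⟨A₀, hA₀⟩ := Q.body_nonempty
  obtain ⟨l, hl, -, hmem⟩ := hT.exists_list Q.body.finite_toSet ⟨A₀, hA₀⟩
  refine ⟨(l ++ [A₀]).map fun A => (A.vars, A), ?_, ?_, ?_, ?_, by simp⟩
  · rw [List.append_nil]
    exact hl.map fun _ _ => rfl
  · intro b hb
    rw [List.append_nil, List.mem_map] at hb
    obtain ⟨A, -, rfl⟩ := hb
    exact subset_rfl
  · intro b hb
    rw [List.append_nil, List.mem_map] at hb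
    obtain ⟨A, hA, rfl⟩ := hb
    exact (hmem A).1 hA
  · intro A hA
    rw [List.append_nil, List.mem_map]
    exact ⟨A, (hmem A).2 hA, rfl⟩

/-- Both join trees are combined. The tree of the body, cut down to head variables, becomes the top
part. It replaces the root of the tree that is rooted at the head: an atom whose parent was the head
is attached to its own trace on the head variables. -/
theorem FreeConnexAcyclic.exists_isDecomposition {Q : ConjQuery ar S Var}
    (h : Q.FreeConnexAcyclic) :
    ∃ L U, Q.IsDecomposition L U ∧ ∀ x ∈ Q.head.vars, ∃ b ∈ U, x ∈ b.1 := by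
  obtain ⟨⟨T₁, hT₁⟩, T₂, hT₂⟩ := h
  obtain ⟨A₀, hA₀⟩ := Q.body_nonempty
  obtain ⟨l₁, hl₁, -, hmem₁⟩ := hT₁.exists_list Q.body.finite_toSet ⟨A₀, hA₀⟩
  have hfin : {A | A ∈ Q.body ∨ A = Q.head}.Finite := by
    classical
    exact (insert Q.head Q.body).finite_toSet.subset fun A hA => by
      simpa [or_comm] using hA
  obtain ⟨l₂, hl₂, hnot, hmem₂⟩ := hT₂.exists_list hfin ⟨Q.head, Or.inr rfl⟩
  simp only at hl₁ hmem₁ hl₂ hnot hmem₂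
  have hmem₂' : ∀ A, A ∈ l₂ ↔ A ∈ Q.body := by
    intro A
    constructor
    · intro hA
      rcases (hmem₂ A).1 (List.mem_append_left _ hA) with h | rfl
      · exact h
      · exact (hnot hA).elim
    · intro hA
      rcases List.mem_append.1 ((hmem₂ A).2 (Or.inl hA)) with h | h
      · exact h
      · obtain rfl := List.mem_singleton.1 h
        exact (Q.head_rel (Q.body_rel _ hA)).elim
  set U : List (Set Var × RelAtom ar Var) :=
    (l₁ ++ [A₀]).map fun A => (A.vars ∩ Q.head.vars, A) with hU
  have hUsub : ∀ b ∈ U, b.1 ⊆ Q.head.vars := by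
    intro b hb
    obtain ⟨A, -, rfl⟩ := List.mem_map.1 hb
    exact Set.inter_subset_right
  have hUmem : ∀ A ∈ Q.body, (A.vars ∩ Q.head.vars, A) ∈ U :=
    fun A hA => List.mem_map.2 ⟨A, (hmem₁ A).2 hA, rfl⟩
  have hUrun : RunningIntersection Prod.fst U := (hl₁.inter Q.head.vars).map fun _ _ => rfl
  have key : ∀ l : List (RelAtom ar Var), (∀ A ∈ l, A ∈ Q.body) →
      RunningIntersection RelAtom.vars (l ++ [Q.head]) →
      RunningIntersection Prod.fst (l.map (fun A => (A.vars, A)) ++ U) := by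
    intro l
    induction l with
    | nil => exact fun _ _ => hUrun
    | cons A l ih =>
      rintro hbody ⟨hl, hw⟩
      refine ⟨ih (fun B hB => hbody B (List.mem_cons_of_mem _ hB)) hl, Or.inr ?_⟩
      rcases hw with hw | ⟨B, hB, hBc⟩
      · simp at hw
      have hcut : ∀ c ∈ l.map (fun A => (A.vars, A)) ++ U, A.vars ∩ c.1 ⊆ B.vars := by
        intro c hc x hx
        rcases List.mem_append.1 hc with hc | hc
        · obtain ⟨C, hC, rfl⟩ := List.mem_map.1 hc
          exact hBc C (List.mem_append_left _ hC) hx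
        · exact hBc Q.head (by simp) ⟨hx.1, hUsub c hc hx.2⟩
      rcases List.mem_append.1 hB with hB | hB
      · exact ⟨(B.vars, B), List.mem_append_left _ (List.mem_map.2 ⟨B, hB, rfl⟩), hcut⟩
      · obtain rfl := List.mem_singleton.1 hB
        exact ⟨_, List.mem_append_right _ (hUmem A (hbody A List.mem_cons_self)),
          fun c hc x hx => ⟨hx.1, hcut c hc hx⟩⟩
  refine ⟨l₂.map fun A => (A.vars, A), U,
    ⟨key l₂ (fun A hA => (hmem₂' A).1 hA) hl₂, ?_, ?_, ?_, hUsub⟩, ?_⟩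
  · intro b hb
    rcases List.mem_append.1 hb with hb | hb
    · obtain ⟨A, -, rfl⟩ := List.mem_map.1 hb
      exact subset_rfl
    · obtain ⟨A, -, rfl⟩ := List.mem_map.1 hb
      exact Set.inter_subset_left
  · intro b hb
    rcases List.mem_append.1 hb with hb | hb
    · obtain ⟨A, hA, rfl⟩ := List.mem_map.1 hb
      exact (hmem₂' A).1 hA
    · obtain ⟨A, hA, rfl⟩ := List.mem_map.1 hb
      exact (hmem₁ A).1 hA
  · intro A hA
    exact List.mem_append_left _ (List.mem_map.2 ⟨A, (hmem₂' A).2 hA, rfl⟩)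
  · intro x hx
    obtain ⟨A, hA, hxA⟩ := Q.safe x hx
    exact ⟨_, hUmem A hA, hxA, hx⟩

/-- Decompositions are inherited by retracts. -/
theorem IsDecomposition.retract {Q Q₀ : ConjQuery ar S Var}
    {L U : List (Set Var × RelAtom ar Var)} (h : Q.IsDecomposition L U)
    (hhead : Q₀.head = Q.head) (hbody : Q₀.body ⊆ Q.body) {e : Var → Var}
    (he : ∀ A ∈ Q.body, A.map e ∈ Q₀.body) (hfix : ∀ x ∈ Q₀.bodyVars, e x = x) :
    Q₀.IsDecomposition (L.map fun b => (b.1 ∩ Q₀.bodyVars, b.2.map e))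
      (U.map fun b => (b.1 ∩ Q₀.bodyVars, b.2.map e)) := by
  constructor
  · rw [← List.map_append]
    exact (h.running.inter Q₀.bodyVars).map fun _ _ => rfl
  · rw [← List.map_append]
    intro b hb
    obtain ⟨c, hc, rfl⟩ := List.mem_map.1 hb
    -- A deleted atom is represented by its image under `e`, which still contains the surviving
    -- variables because `e` fixes them.
    rintro x ⟨hx, hx₀⟩
    simp only [RelAtom.vars_map]
    exact ⟨x, h.bag_subset c hc hx, hfix x hx₀⟩
  · rw [← List.map_append]
    intro b hb
    obtain ⟨c, hc, rfl⟩ := List.mem_map.1 hb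
    exact he _ (h.atom_mem c hc)
  · rw [← List.map_append]
    intro A hA
    refine List.mem_map.2 ⟨_, h.mem_of_mem_body A (hbody hA), Prod.ext ?_ ?_⟩
    · exact Set.inter_eq_left.2 fun x hx => ⟨A, hA, hx⟩
    · exact RelAtom.map_eq_self fun x hx => hfix x ⟨A, hA, hx⟩
  · intro b hb
    obtain ⟨c, hc, rfl⟩ := List.mem_map.1 hb
    rw [hhead]
    exact Set.inter_subset_left.trans (h.root_subset c hc)

end ConjQuery

/-! ### Contraction of components in a tree on the natural numbers -/

section Components

/-- Reversing the list numbers its members from the root, so that parents have smaller indices. -/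
theorem RunningIntersection.exists_parent {α X : Type*} {f : α → Set X} (d : α) :
    ∀ {l : List α}, RunningIntersection f l → ∀ i, 0 < i → i < l.length →
      ∃ p < i, ∀ j < i,
        f (l.reverse.getD i d) ∩ f (l.reverse.getD j d) ⊆ f (l.reverse.getD p d)
  | [], _, i, _, hi => by simp at hi
  | a :: l, ⟨hl, hw⟩, i, hi₀, hi => by
    have hlt : ∀ j < l.length, (a :: l).reverse.getD j d = l.reverse.getD j d := by
      intro j hj
      rw [List.reverse_cons, List.getD_append _ _ _ _ (by simpa using hj)]
    rw [List.length_cons] at hi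
    rcases Nat.lt_succ_iff_lt_or_eq.1 hi with hi | rfl
    · obtain ⟨p, hp, h⟩ := hl.exists_parent d i hi₀ hi
      refine ⟨p, hp, fun j hj => ?_⟩
      rw [hlt i hi, hlt j (hj.trans hi), hlt p (hp.trans hi)]
      exact h j hj
    · have ha : (a :: l).reverse.getD l.length d = a := by
        rw [List.reverse_cons, List.getD_append_right _ _ _ _ (by simp)]
        simp
      rcases hw with rfl | ⟨b, hb, hbc⟩
      · simp at hi₀
      · obtain ⟨p, hp, rfl⟩ := List.getElem_of_mem (List.mem_reverse.2 hb)
        rw [List.length_reverse] at hp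
        refine ⟨p, hp, fun j hj => ?_⟩
        rw [ha, hlt p hp, hlt j hj, List.getD_eq_getElem _ _ (by simpa using hj),
          List.getD_eq_getElem _ _ (by simpa using hp)]
        exact hbc _ (List.mem_reverse.1 (List.getElem_mem _))

theorem runningIntersection_range {X : Type*} {b : ℕ → Set X}
    (hb : ∀ i, 0 < i → ∃ p < i, ∀ j < i, b i ∩ b j ⊆ b p) :
    ∀ n, RunningIntersection id ((List.range n).map b).reverse
  | 0 => trivial
  | n + 1 => by
    rw [List.range_succ, List.map_append, List.reverse_append]
    refine ⟨runningIntersection_range hb n, ?_⟩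
    rcases Nat.eq_zero_or_pos n with rfl | hn
    · exact Or.inl rfl
    · obtain ⟨p, hp, h⟩ := hb n hn
      refine Or.inr ⟨b p, ?_, fun c hc => ?_⟩
      · change b p ∈ ((List.range n).map b).reverse
        simp only [List.mem_reverse, List.mem_map, List.mem_range]
        exact ⟨p, hp, rfl⟩
      · change c ∈ ((List.range n).map b).reverse at hc
        simp only [List.mem_reverse, List.mem_map, List.mem_range] at hc
        obtain ⟨j, hj, rfl⟩ := hc
        exact h j hj

/-- Attaches the sets `w c` as leaves: what such a set shares with the tree and with earlier leaves
lies in one tree node. -/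
theorem RunningIntersection.append_range {X : Type*} {l : List (Set X)} {w : ℕ → Set X}
    (hl : RunningIntersection id l) : ∀ n, (∀ c < n, ∃ b ∈ l, (∀ s ∈ l, w c ∩ s ⊆ b) ∧
      ∀ c' < c, w c ∩ w c' ⊆ b) → RunningIntersection id (((List.range n).map w).reverse ++ l)
  | 0, _ => hl
  | n + 1, h => by
    rw [List.range_succ, List.map_append, List.reverse_append]
    refine ⟨hl.append_range n fun c hc => h c (hc.trans n.lt_succ_self), Or.inr ?_⟩
    obtain ⟨b, hb, hbl, hbw⟩ := h n n.lt_succ_self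
    refine ⟨b, List.mem_append_right _ hb, fun c hc => ?_⟩
    change c ∈ ((List.range n).map w).reverse ++ l at hc
    rcases List.mem_append.1 hc with hc | hc
    · simp only [List.mem_reverse, List.mem_map, List.mem_range] at hc
      obtain ⟨j, hj, rfl⟩ := hc
      exact hbw j hj
    · exact hbl c hc

open Classical in
/-- The root of the component of `i` if each `j` with `merge j` is merged with its parent `p j`. -/
noncomputable def componentRoot (p : ℕ → ℕ) (merge : ℕ → Prop) (i : ℕ) : ℕ :=
  if _h : merge i ∧ p i < i then componentRoot p merge (p i) else i
termination_by i
decreasing_by exact _h.2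

variable {X : Type*} {p : ℕ → ℕ} {merge : ℕ → Prop} {χ : ℕ → Set X}

theorem componentRoot_of_merge {i : ℕ} (h : merge i) (hi : p i < i) :
    componentRoot p merge i = componentRoot p merge (p i) := by
  rw [componentRoot, dif_pos ⟨h, hi⟩]

theorem componentRoot_eq_or (p : ℕ → ℕ) (merge : ℕ → Prop) (i : ℕ) :
    componentRoot p merge i = i ∨
      merge i ∧ p i < i ∧ componentRoot p merge i = componentRoot p merge (p i) := by
  by_cases h : merge i ∧ p i < i
  · exact Or.inr ⟨h.1, h.2, componentRoot_of_merge h.1 h.2⟩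
  · left
    rw [componentRoot, dif_neg h]

theorem componentRoot_le (p : ℕ → ℕ) (merge : ℕ → Prop) (i : ℕ) :
    componentRoot p merge i ≤ i := by
  induction i using Nat.strong_induction_on with
  | _ i ih =>
    rcases componentRoot_eq_or p merge i with h | ⟨-, hp, h⟩
    · exact h.le
    · exact h ▸ (ih _ hp).trans hp.le

/-- What does not change under merging does not change under passing to the component root. -/
theorem apply_componentRoot {β : Type*} {q : ℕ → β} (hq : ∀ i, merge i → p i < i → q (p i) = q i)
    (i : ℕ) : q (componentRoot p merge i) = q i := by
  induction i using Nat.strong_induction_on with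
  | _ i ih =>
    rcases componentRoot_eq_or p merge i with h | ⟨hm, hp, h⟩
    · rw [h]
    · rw [h, ih _ hp, hq i hm hp]

theorem componentRoot_componentRoot (p : ℕ → ℕ) (merge : ℕ → Prop) (i : ℕ) :
    componentRoot p merge (componentRoot p merge i) = componentRoot p merge i :=
  apply_componentRoot (fun _ hm hi => (componentRoot_of_merge hm hi).symm) i

/-- The union of the sets in a component. -/
def componentSet (p : ℕ → ℕ) (merge : ℕ → Prop) (χ : ℕ → Set X) (c : ℕ) : Set X :=
  {x | ∃ k, componentRoot p merge k = c ∧ x ∈ χ k}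

/-- In a tree with the running intersection property, the nodes whose set contains a given element
have a topmost node, and are closed under parents apart from that. -/
theorem exists_top (hp : ∀ i, 0 < i → p i < i ∧ ∀ j < i, χ i ∩ χ j ⊆ χ (p i)) {x : X} {k₀ : ℕ}
    (hk₀ : x ∈ χ k₀) :
    ∃ t, x ∈ χ t ∧ ∀ k, x ∈ χ k → k ≠ t → p k < k ∧ t < k ∧ x ∈ χ (p k) := by
  classical
  have hex : ∃ k, x ∈ χ k := ⟨k₀, hk₀⟩
  -- The topmost node is the one of least index.
  refine ⟨Nat.find hex, Nat.find_spec hex, fun k hk hne => ?_⟩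
  have hlt : Nat.find hex < k := lt_of_le_of_ne (Nat.find_min' hex hk) hne.symm
  have := hp k (Nat.zero_lt_of_lt hlt)
  exact ⟨this.1, hlt, this.2 _ hlt ⟨hk, Nat.find_spec hex⟩⟩

/-- Contracting connected components preserves the running intersection property. -/
theorem componentSet_inter_subset
    (hp : ∀ i, 0 < i → p i < i ∧ ∀ j < i, χ i ∩ χ j ⊆ χ (p i)) {i j : ℕ} (hj : j < i) :
    componentSet p merge χ (componentRoot p merge i) ∩
      componentSet p merge χ (componentRoot p merge j) ⊆
        componentSet p merge χ (componentRoot p merge (p i)) := by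
  rcases componentRoot_eq_or p merge i with h | ⟨-, -, h⟩
  swap
  · rw [h]
    exact Set.inter_subset_left
  rintro x ⟨⟨k, hk, hxk⟩, k', hk', hxk'⟩
  obtain ⟨t, -, htop⟩ := exists_top hp hxk
  -- Climbing from k to t, the component root never increases.
  have hge : ∀ k, x ∈ χ k → componentRoot p merge t ≤ componentRoot p merge k := by
    intro k
    induction k using Nat.strong_induction_on with
    | _ k ih =>
      intro hxk
      by_cases hkt : k = t
      · rw [hkt]
      obtain ⟨hpk, htk, hxp⟩ := htop k hxk hkt
      rcases componentRoot_eq_or p merge k with h | ⟨-, -, h⟩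
      · rw [h]
        exact (componentRoot_le p merge t).trans htk.le
      · rw [h]
        exact ih _ hpk hxp
  -- The climb from k to t must leave the component of k through its root, so the parent of that
  -- root contains x.
  have hpar : ∀ k, x ∈ χ k → componentRoot p merge k ≠ componentRoot p merge t →
      x ∈ χ (p (componentRoot p merge k)) := by
    intro k
    induction k using Nat.strong_induction_on with
    | _ k ih =>
      intro hxk hne
      obtain ⟨hpk, htk, hxp⟩ := htop k hxk fun e => hne (by rw [e])
      rcases componentRoot_eq_or p merge k with h | ⟨-, -, h⟩
      · rw [h]
        exact hxp
      · rw [h] at hne ⊢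
        exact ih _ hpk hxp hne
  refine ⟨p i, rfl, ?_⟩
  -- Otherwise i would be the least root among components containing x, although the root for j is
  -- at most j < i.
  have hne : componentRoot p merge k ≠ componentRoot p merge t := by
    intro e
    have h1 := hge k' hxk'
    have h2 := componentRoot_le p merge j
    omega
  have := hpar k hxk hne
  rwa [hk, h] at this

end Components

/-! ### Homomorphisms into expansions of view applications -/

namespace ConjQuery

variable {R Var Var' Dom : Type*} {ar : R → ℕ} {S : Set R}

open Classical in
/-- The canonical valuation of a view under an application: head variables are mapped according to
the application, all other variables to fresh values. -/
noncomputable def expand (i : ConjQuery ar S Var × (Var → Var)) (z : Var) :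
    Var ⊕ (ConjQuery ar S Var × (Var → Var)) × Var :=
  if z ∈ i.1.head.vars then Sum.inl (i.2 z) else Sum.inr (i, z)

/-- A query with a rewriting maps into the expansion of a set of applications of views to the
query. If the query is a core, this map is injective. -/
theorem IsRewriting.exists_hom [Infinite Dom] [Nonempty Var] {𝒱 : Set (ConjQuery ar S Var)}
    {Q : ConjQuery ar S Var} {Q' : ConjQuery ar (viewSchema 𝒱) Var}
    (hQ' : IsRewriting Dom 𝒱 Q Q')
    (hcore : ∀ e : Var → Var, (∀ A ∈ Q.body, A.map e ∈ Q.body) → (∀ x ∈ Q.head.vars, e x = x) →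
      Set.InjOn e Q.bodyVars) :
    Q.head.rel ∉ viewSchema 𝒱 ∧
    ∃ (ω : RelAtom ar Var → ConjQuery ar S Var × (Var → Var))
      (h : Var → Var ⊕ (ConjQuery ar S Var × (Var → Var)) × Var),
      Set.InjOn h Q.bodyVars ∧ (∀ x ∈ Q.head.vars, h x = Sum.inl x) ∧
      ∀ A ∈ Q.body, (ω A).1 ∈ 𝒱 ∧ (∀ B ∈ (ω A).1.body, B.map (ω A).2 ∈ Q.body) ∧
        ∃ B ∈ (ω A).1.body, A.map h = B.map (expand (ω A)) := by
  classical
  -- The body of Q serves as its own canonical database, with variables as data values.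
  have h₁ := hQ'.change_domain (Dom' := Var) (Q.body : Set (RelAtom ar Var))
    ⟨Q.body.finite_toSet, Q.body_rel⟩
  have hhead : Q.head ∈ Q.eval (Q.body : Set (RelAtom ar Var)) := ⟨id, fun A hA => hA, rfl⟩
  rw [← h₁] at hhead
  obtain ⟨g, hg, hgh⟩ := hhead
  have hψ : ∀ W, ∃ i : ConjQuery ar S Var × (Var → Var), W ∈ Q'.body →
      i.1 ∈ 𝒱 ∧ (∀ B ∈ i.1.body, B.map i.2 ∈ Q.body) ∧ W.map g = i.1.head.map i.2 := by
    intro W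
    by_cases hW : W ∈ Q'.body
    · obtain ⟨V, hV, μ, hμ, hWV⟩ := hg W hW
      exact ⟨(V, μ), fun _ => ⟨hV, hμ, hWV⟩⟩
    · exact ⟨(Q, id), fun h => (hW h).elim⟩
  choose ψ hψ using hψ
  -- The expansion as a database. Fresh values are tagged with the application, so a private value
  -- determines its application.
  have hD : IsDatabase S {F | ∃ W ∈ Q'.body, ∃ B ∈ (ψ W).1.body, F = B.map (expand (ψ W))} := by
    constructor
    · have : {F | ∃ W ∈ Q'.body, ∃ B ∈ (ψ W).1.body, F = B.map (expand (ψ W))} =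
          ⋃ W ∈ (Q'.body : Set _), (RelAtom.map (expand (ψ W))) '' ((ψ W).1.body : Set _) := by
        ext F
        simp [eq_comm]
      rw [this]
      exact Q'.body.finite_toSet.biUnion fun W _ => (ψ W).1.body.finite_toSet.image _
    · rintro F ⟨W, -, B, hB, rfl⟩
      exact (ψ W).1.body_rel B hB
  have h₂ := hQ'.change_domain _ hD
  have hmem : Q'.head.map (fun x => Sum.inl (g x)) ∈ Q'.eval (viewDatabase 𝒱
      {F | ∃ W ∈ Q'.body, ∃ B ∈ (ψ W).1.body, F = B.map (expand (ψ W))}) := by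
    refine ⟨_, fun W hW => ?_, rfl⟩
    obtain ⟨hV, -, hWV⟩ := hψ W hW
    refine ⟨(ψ W).1, hV, expand (ψ W), fun B hB => ⟨W, hW, B, hB, rfl⟩, ?_⟩
    rw [← RelAtom.map_map, hWV, RelAtom.map_map]
    exact RelAtom.map_congr fun z hz => (if_pos hz).symm
  rw [h₂, ← RelAtom.map_map, ← hgh] at hmem
  obtain ⟨h, hh, hhh⟩ := hmem
  refine ⟨?_, ?_⟩
  · rw [hgh]
    exact Q'.head_rel
  have hω : ∀ A, ∃ i : ConjQuery ar S Var × (Var → Var), A ∈ Q.body →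
      i.1 ∈ 𝒱 ∧ (∀ B ∈ i.1.body, B.map i.2 ∈ Q.body) ∧
        ∃ B ∈ i.1.body, A.map h = B.map (expand i) := by
    intro A
    by_cases hA : A ∈ Q.body
    · obtain ⟨W, hW, hB⟩ := hh A hA
      obtain ⟨hV, hμ, -⟩ := hψ W hW
      exact ⟨ψ W, fun _ => ⟨hV, hμ, hB⟩⟩
    · exact ⟨(Q, id), fun h => (hA h).elim⟩
  choose ω hω using hω
  have hfix : ∀ x ∈ Q.head.vars, h x = Sum.inl x :=
    fun x hx => (RelAtom.eq_of_map_eq_map hhh x hx).symm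
  refine ⟨ω, h, ?_, hfix, hω⟩
  -- The map π undoes every expansion, so π ∘ h is an endomorphism of Q fixing the head, hence
  -- injective on the core.
  let π : Var ⊕ (ConjQuery ar S Var × (Var → Var)) × Var → Var :=
    Sum.elim id fun j => j.1.2 j.2
  have hπ : ∀ i z, π (expand i z) = i.2 z := by
    intro i z
    unfold expand
    split_ifs <;> rfl
  have hinj := hcore (fun x => π (h x)) (fun A hA => by
    obtain ⟨-, hμ, B, hB, hAB⟩ := hω A hA
    rw [← RelAtom.map_map, hAB, RelAtom.map_map]
    simp only [hπ]
    exact hμ B hB) (fun x hx => by simp [hfix x hx, π])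
  exact fun x hx y hy hxy => hinj hx hy (congrArg π hxy)

/-- Every query can be written with the variables in a given infinite set. -/
theorem exists_rename [Infinite Var] [Nonempty Var'] (Q : ConjQuery ar S Var') :
    ∃ (φ : Var' → Var) (Q₁ : ConjQuery ar S Var), Set.InjOn φ Q.bodyVars ∧
      Q₁.head = Q.head.map φ ∧ (∀ A, A ∈ Q₁.body ↔ ∃ B ∈ Q.body, B.map φ = A) ∧
      ∀ D : Set (RelAtom ar Dom), Q₁.eval D = Q.eval D := by
  classical
  obtain ⟨φ, hφ⟩ := Q.finite_bodyVars.exists_injOn_of_infinite (Y := Var)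
  let Q₁ : ConjQuery ar S Var :=
    { head := Q.head.map φ
      body := Q.body.image (RelAtom.map φ)
      body_nonempty := Q.body_nonempty.image _
      body_rel := fun A hA => by
        obtain ⟨B, hB, rfl⟩ := Finset.mem_image.1 hA
        exact Q.body_rel B hB
      head_rel := Q.head_rel
      safe := fun x hx => by
        rw [RelAtom.vars_map] at hx
        obtain ⟨y, hy, rfl⟩ := hx
        obtain ⟨A, hA, hyA⟩ := Q.safe y hy
        refine ⟨_, Finset.mem_image_of_mem _ hA, ?_⟩
        rw [RelAtom.vars_map]
        exact ⟨y, hyA, rfl⟩ }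
  refine ⟨φ, Q₁, hφ, rfl, fun A => Finset.mem_image, fun D => Set.Subset.antisymm ?_ ?_⟩
  · exact eval_subset_of_hom φ (fun A hA => Finset.mem_image_of_mem _ hA) rfl D
  · have hinv := hφ.leftInvOn_invFunOn
    have hback : ∀ A ∈ Q.body, (A.map φ).map (Function.invFunOn φ Q.bodyVars) = A :=
      fun A hA => RelAtom.map_eq_self fun x hx => hinv ⟨A, hA, hx⟩
    refine eval_subset_of_hom (Function.invFunOn φ Q.bodyVars) (fun A hA => ?_) ?_ D
    · obtain ⟨B, hB, rfl⟩ := Finset.mem_image.1 hA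
      rw [hback B hB]
      exact hB
    · exact RelAtom.map_eq_self fun x hx => hinv (Q.safe x hx)

/-! ### Acyclicity from running intersections -/

theorem acyclic_of_runningIntersection {Q : ConjQuery ar S Var} {l : List (Set Var)}
    (hl : RunningIntersection id l) (h₁ : ∀ b ∈ l, ∃ A ∈ Q.body, b ⊆ A.vars)
    (h₂ : ∀ A ∈ Q.body, ∃ b ∈ l, A.vars ⊆ b) : Q.Acyclic := by
  classical
  exact (RunningIntersection.earDecomposable _ le_rfl Q.body_nonempty hl h₁ h₂).exists_isJoinTree
    fun _ => Iff.rfl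

/-- The sets in U together form the head variables, so the head can replace them as the root. Since
L alone covers the body atoms, no cover is lost. -/
theorem freeConnexAcyclic_of_runningIntersection {Q : ConjQuery ar S Var} {L U : List (Set Var)}
    (hl : RunningIntersection id (L ++ U)) (h₁ : ∀ b ∈ L ++ U, ∃ A ∈ Q.body, b ⊆ A.vars)
    (h₂ : ∀ A ∈ Q.body, ∃ b ∈ L, A.vars ⊆ b)
    (hU : ∀ x, x ∈ Q.head.vars ↔ ∃ b ∈ U, x ∈ b) : Q.FreeConnexAcyclic := by
  classical
  refine ⟨acyclic_of_runningIntersection hl h₁ fun A hA => ?_, ?_⟩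
  · obtain ⟨b, hb, hAb⟩ := h₂ A hA
    exact ⟨b, List.mem_append_left _ hb, hAb⟩
  · refine (RunningIntersection.earDecomposable (s := insert Q.head Q.body) _ le_rfl
      (Finset.insert_nonempty _ _) (hl.append_singleton hU) ?_ ?_).exists_isJoinTree fun A => by
        simp [or_comm]
    · intro b hb
      rcases List.mem_append.1 hb with hb | hb
      · obtain ⟨A, hA, hbA⟩ := h₁ b (List.mem_append_left _ hb)
        exact ⟨A, Finset.mem_insert_of_mem hA, hbA⟩
      · obtain rfl := List.mem_singleton.1 hb
        exact ⟨_, Finset.mem_insert_self _ _, subset_rfl⟩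
    · intro A hA
      rcases Finset.mem_insert.1 hA with rfl | hA
      · exact ⟨_, List.mem_append_right _ (List.mem_singleton_self _), subset_rfl⟩
      · obtain ⟨b, hb, hAb⟩ := h₂ A hA
        exact ⟨b, List.mem_append_left _ hb, hAb⟩

end ConjQuery

/-! ### The rewriting along a decomposition -/

namespace ConjQuery

variable {R Var Dom : Type*} {ar : R → ℕ} {S : Set R}

/-- A decomposition of a query whose nodes are the natural numbers below `n`, in an order in which
parents come first and the nodes below `m` are the roots that carry head variables only. -/
structure IsIndexedDecomposition (Q : ConjQuery ar S Var) (n m : ℕ) (χ : ℕ → Set Var)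
    (α : ℕ → RelAtom ar Var) (p : ℕ → ℕ) : Prop where
  le : m ≤ n
  parent : ∀ i, 0 < i → p i < i ∧ ∀ j < i, χ i ∩ χ j ⊆ χ (p i)
  bag_subset : ∀ i, χ i ⊆ (α i).vars
  atom_mem : ∀ i, α i ∈ Q.body
  exists_index : ∀ A ∈ Q.body, ∃ i < n, α i = A ∧ χ i = A.vars
  root_subset : ∀ i < m, χ i ⊆ Q.head.vars

theorem IsDecomposition.exists_indexed {Q : ConjQuery ar S Var}
    {L U : List (Set Var × RelAtom ar Var)} (h : Q.IsDecomposition L U) :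
    ∃ n m χ α p, Q.IsIndexedDecomposition n m χ α p ∧ ∀ b ∈ U, ∃ i < m, χ i = b.1 := by
  classical
  obtain ⟨A₀, hA₀⟩ := Q.body_nonempty
  -- The empty default bag makes the parent condition trivial beyond the list, so it holds for all
  -- positive indices.
  set d : Set Var × RelAtom ar Var := (∅, A₀) with hd
  set l := (L ++ U).reverse with hl
  have hout : ∀ i, ¬ i < (L ++ U).length → l.getD i d = d := fun i hi =>
    List.getD_eq_default _ _ (by rw [hl, List.length_reverse]; exact not_lt.1 hi)
  have hcase : ∀ i, l.getD i d ∈ L ++ U ∨ l.getD i d = d := by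
    intro i
    by_cases hi : i < (L ++ U).length
    · left
      have hi' : i < l.length := by rw [hl, List.length_reverse]; exact hi
      rw [List.getD_eq_getElem _ _ hi']
      exact List.mem_reverse.1 (List.getElem_mem hi')
    · exact Or.inr (hout i hi)
  have hp : ∀ i, ∃ p, 0 < i → p < i ∧
      ∀ j < i, (l.getD i d).1 ∩ (l.getD j d).1 ⊆ (l.getD p d).1 := by
    intro i
    by_cases hi₀ : 0 < i
    · by_cases hi : i < (L ++ U).length
      · obtain ⟨p, hp, hpi⟩ := h.running.exists_parent d i hi₀ hi
        exact ⟨p, fun _ => ⟨hp, hpi⟩⟩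
      · refine ⟨0, fun _ => ⟨hi₀, fun j _ x hx => ?_⟩⟩
        rw [hout i hi] at hx
        exact hx.1.elim
    · exact ⟨0, fun h => (hi₀ h).elim⟩
  choose p hp using hp
  have hlU : ∀ i < U.length, l.getD i d ∈ U := by
    intro i hi
    rw [hl, List.reverse_append, List.getD_append _ _ _ _ (by simpa using hi),
      List.getD_eq_getElem _ _ (by simpa using hi)]
    exact List.mem_reverse.1 (List.getElem_mem _)
  refine ⟨(L ++ U).length, U.length, fun i => (l.getD i d).1, fun i => (l.getD i d).2, p,
    ⟨by simp, hp, fun i => ?_, fun i => ?_, fun A hA => ?_,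
      fun i hi => h.root_subset _ (hlU i hi)⟩, fun b hb => ?_⟩
  · rcases hcase i with hi | hi
    · exact h.bag_subset _ hi
    · rw [hi]
      exact Set.empty_subset _
  · rcases hcase i with hi | hi
    · exact h.atom_mem _ hi
    · rw [hi]
      exact hA₀
  · obtain ⟨i, hi, hiA⟩ := List.getElem_of_mem (List.mem_reverse.2 (h.mem_of_mem_body A hA))
    refine ⟨i, by rwa [List.length_reverse] at hi, ?_⟩
    have : l.getD i d = (A.vars, A) := by rw [List.getD_eq_getElem _ _ hi, hiA]
    simp only [this, and_self]
  · obtain ⟨i, hi, hib⟩ := List.getElem_of_mem (List.mem_reverse.2 hb)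
    refine ⟨i, by simpa using hi, ?_⟩
    have : l.getD i d = b := by
      rw [hl, List.reverse_append, List.getD_append _ _ _ _ hi, List.getD_eq_getElem _ _ hi, hib]
    simp only [this]

open Classical in
/-- The renaming of the `c`-th copy of an atom: a variable `y` that represents an element `x` of `C`
becomes `x`, every other variable becomes fresh. -/
noncomputable def splitVar {β : Type*} (h : Var → Var ⊕ β) (C : Set Var) (c : ℕ) (y : Var) :
    Var ⊕ ℕ × Var :=
  if hx : ∃ x ∈ C, h x = Sum.inl y then Sum.inl hx.choose else Sum.inr (c, y)

/-- Injectivity of h leaves only one candidate for the choice in `splitVar`. -/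
theorem splitVar_eq {β : Type*} {h : Var → Var ⊕ β} {s C : Set Var} (hs : Set.InjOn h s)
    (hC : C ⊆ s) {c : ℕ} {x y : Var} (hx : x ∈ C) (hxy : h x = Sum.inl y) :
    splitVar h C c y = Sum.inl x := by
  have hex : ∃ x ∈ C, h x = Sum.inl y := ⟨x, hx, hxy⟩
  rw [splitVar, dif_pos hex]
  exact congrArg Sum.inl
    (hs (hC hex.choose_spec.1) (hC hx) (hex.choose_spec.2.trans hxy.symm))

theorem splitVar_cases {β : Type*} (h : Var → Var ⊕ β) (C : Set Var) (c : ℕ) (y : Var) :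
    (∃ x ∈ C, h x = Sum.inl y ∧ splitVar h C c y = Sum.inl x) ∨
      splitVar h C c y = Sum.inr (c, y) := by
  by_cases hx : ∃ x ∈ C, h x = Sum.inl y
  · exact Or.inl ⟨_, hx.choose_spec.1, hx.choose_spec.2, by rw [splitVar, dif_pos hx]⟩
  · exact Or.inr (by rw [splitVar, dif_neg hx])

theorem expand_eq_inl {i : ConjQuery ar S Var × (Var → Var)} {z y : Var}
    (h : expand i z = Sum.inl y) : z ∈ i.1.head.vars ∧ i.2 z = y := by
  unfold expand at h
  split_ifs at h with hz
  exact ⟨hz, Sum.inl.inj h⟩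

theorem expand_eq_inr {i j : ConjQuery ar S Var × (Var → Var)} {z y : Var}
    (h : expand i z = Sum.inr (j, y)) : i = j ∧ z = y := by
  unfold expand at h
  split_ifs at h with hz
  exact Prod.mk.inj (Sum.inr.inj h)

/-- The rewriting along a decomposition: for each component of the nodes with a common application
of a view it uses a separate copy of this application. -/
theorem IsIndexedDecomposition.exists_rewriting [Nonempty Dom]
    {𝒱 : Set (ConjQuery ar S Var)}
    (h𝒱 : Set.InjOn (fun V : ConjQuery ar S Var => V.head.rel) 𝒱)
    {Q : ConjQuery ar S Var} {n m : ℕ} {χ : ℕ → Set Var} {α : ℕ → RelAtom ar Var} {p : ℕ → ℕ}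
    (hQ : Q.IsIndexedDecomposition n m χ α p) (hrel : Q.head.rel ∉ viewSchema 𝒱)
    {ω : RelAtom ar Var → ConjQuery ar S Var × (Var → Var)}
    {h : Var → Var ⊕ (ConjQuery ar S Var × (Var → Var)) × Var}
    (hinj : Set.InjOn h Q.bodyVars) (hhead : ∀ x ∈ Q.head.vars, h x = Sum.inl x)
    (hω : ∀ A ∈ Q.body, (ω A).1 ∈ 𝒱 ∧ (∀ B ∈ (ω A).1.body, B.map (ω A).2 ∈ Q.body) ∧
      ∃ B ∈ (ω A).1.body, A.map h = B.map (expand (ω A))) :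
    ∃ (Q₁ : ConjQuery ar (viewSchema 𝒱) (Var ⊕ ℕ × Var)) (L U : List (Set (Var ⊕ ℕ × Var))),
      (∀ D : Set (RelAtom ar Dom), Q₁.eval (viewDatabase 𝒱 D) = Q.eval D) ∧
      RunningIntersection id (L ++ U) ∧ (∀ b ∈ L ++ U, ∃ A ∈ Q₁.body, b ⊆ A.vars) ∧
      (∀ A ∈ Q₁.body, ∃ b ∈ L, A.vars ⊆ b) ∧ (∀ b ∈ U, b ⊆ Q₁.head.vars) ∧
      ((∀ x ∈ Q.head.vars, ∃ i < m, x ∈ χ i) → ∀ x ∈ Q₁.head.vars, ∃ b ∈ U, x ∈ b) := by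
  classical
  -- Nodes below m are never merged, so that their bags keep to head variables.
  set merge : ℕ → Prop := fun i => m ≤ i ∧ m ≤ p i ∧ ω (α (p i)) = ω (α i)
  set r := componentRoot p merge
  set C := componentSet p merge χ
  have hCsub : ∀ c, C c ⊆ Q.bodyVars := by
    rintro c x ⟨k, -, hx⟩
    exact ⟨_, hQ.atom_mem k, hQ.bag_subset k hx⟩
  have hωr : ∀ i, ω (α (r i)) = ω (α i) :=
    apply_componentRoot (q := fun i => ω (α i)) fun _ hm _ => hm.2.2
  have hrr : ∀ i, r (r i) = r i := componentRoot_componentRoot p merge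
  have hrle : ∀ i, r i ≤ i := componentRoot_le p merge
  have hroot : ∀ k, r k < m → r k = k := by
    intro k hk
    have hkm : (r k < m) = (k < m) :=
      apply_componentRoot (q := fun i => i < m) (fun i hm _ =>
        propext (iff_of_false (not_lt.2 hm.2.1) (not_lt.2 hm.1))) k
    rcases componentRoot_eq_or p merge k with hrk | ⟨hm, -⟩
    · exact hrk
    · rw [hkm] at hk
      exact absurd hk (not_lt.2 hm.1)
  have hentry : ∀ k, ∀ x ∈ χ k, ∃ z, h x = expand (ω (α k)) z := by
    intro k x hx
    obtain ⟨-, -, B, -, hB⟩ := hω _ (hQ.atom_mem k)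
    obtain ⟨z, -, hz⟩ := RelAtom.exists_of_map_eq_map hB (hQ.bag_subset k hx)
    exact ⟨z, hz⟩
  set σ : ℕ → Var → Var ⊕ ℕ × Var := fun c => splitVar h (C c) c
  have hσC : ∀ {c x y}, x ∈ C c → h x = Sum.inl y → σ c y = Sum.inl x :=
    fun {c x y} hx hxy => splitVar_eq hinj (hCsub c) hx hxy
  -- An index c that is not a component root is harmless: its component is empty and its copy has
  -- fresh variables only.
  set W : ℕ → RelAtom ar (Var ⊕ ℕ × Var) := fun c =>
    ((ω (α c)).1.head.map (ω (α c)).2).map (σ c)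
  have hWvars : ∀ c, (W c).vars =
      (fun z => σ c ((ω (α c)).2 z)) '' (ω (α c)).1.head.vars := fun c => by
    rw [← RelAtom.vars_map]
    rfl
  have hcover : ∀ {c x y}, x ∈ C c → h x = Sum.inl y → Sum.inl x ∈ (W c).vars := by
    intro c x y hx hxy
    obtain ⟨k, hk, hxk⟩ := id hx
    obtain ⟨z, hz⟩ := hentry k x hxk
    rw [← hωr k] at hz
    change r k = c at hk
    rw [hk, hxy] at hz
    obtain ⟨hzh, hzy⟩ := expand_eq_inl hz.symm
    rw [hWvars]
    exact ⟨z, hzh, by simp only [hzy]; exact hσC hx hxy⟩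
  have hWcases : ∀ c, ∀ Y ∈ (W c).vars,
      (∃ x ∈ C c, (∃ y, h x = Sum.inl y) ∧ Y = Sum.inl x) ∨ ∃ y, Y = Sum.inr (c, y) := by
    intro c Y hY
    rw [hWvars] at hY
    obtain ⟨z, -, rfl⟩ := hY
    rcases splitVar_cases h (C c) c ((ω (α c)).2 z) with ⟨x, hx, hxy, he⟩ | he
    · exact Or.inl ⟨x, hx, ⟨_, hxy⟩, he⟩
    · exact Or.inr ⟨_, he⟩
  obtain ⟨n₀, hn₀⟩ : ∃ c, c < n := by
    obtain ⟨A, hA⟩ := Q.body_nonempty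
    obtain ⟨i, hi, -⟩ := hQ.exists_index A hA
    exact ⟨i, hi⟩
  let Q₁ : ConjQuery ar (viewSchema 𝒱) (Var ⊕ ℕ × Var) :=
    { head := Q.head.map Sum.inl
      body := (Finset.range n).image W
      body_nonempty := ⟨W n₀, Finset.mem_image_of_mem _ (Finset.mem_range.2 hn₀)⟩
      body_rel := fun A hA => by
        obtain ⟨c, -, rfl⟩ := Finset.mem_image.1 hA
        exact ⟨_, (hω _ (hQ.atom_mem c)).1, rfl⟩
      head_rel := hrel
      safe := fun x hx => by
        rw [RelAtom.vars_map] at hx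
        obtain ⟨y, hy, rfl⟩ := hx
        obtain ⟨A, hA, hyA⟩ := Q.safe y hy
        obtain ⟨i, hi, -, hiA⟩ := hQ.exists_index A hA
        exact ⟨W (r i), Finset.mem_image_of_mem _ (Finset.mem_range.2 ((hrle i).trans_lt hi)),
          hcover ⟨i, rfl, hiA ▸ hyA⟩ (hhead y hy)⟩ }
  have hQ₁ : ∀ c < n, W c ∈ Q₁.body :=
    fun c hc => Finset.mem_image_of_mem _ (Finset.mem_range.2 hc)
  have heval : ∀ D : Set (RelAtom ar Dom), Q₁.eval (viewDatabase 𝒱 D) = Q.eval D := by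
    intro D
    apply Set.Subset.antisymm
    · rintro F ⟨ν, hν, rfl⟩
      -- The head symbol identifies the view, so the image of each copy comes with a valuation of
      -- the whole view body.
      have hρ : ∀ c, ∃ ρ : Var → Dom, c < n → (∀ B ∈ (ω (α c)).1.body, B.map ρ ∈ D) ∧
          ∀ z ∈ (ω (α c)).1.head.vars, ν (σ c ((ω (α c)).2 z)) = ρ z := by
        intro c
        by_cases hc : c < n
        · obtain ⟨V, hV, ρ, hρ, hWρ⟩ := hν _ (hQ₁ c hc)
          have hVω : (ω (α c)).1 = V :=
            h𝒱 (hω _ (hQ.atom_mem c)).1 hV (congrArg (fun F : RelAtom ar Dom => F.rel) hWρ :)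
          subst hVω
          exact ⟨ρ, fun _ => ⟨hρ, RelAtom.eq_of_map_eq_map hWρ⟩⟩
        · exact ⟨fun _ => Classical.arbitrary Dom, fun h => (hc h).elim⟩
      choose ρ hρ using hρ
      -- The gluing argument: if `h x` is private to i, all nodes containing x lie outside the top
      -- part, carry the label i and are linked through parents, so they are merged into one
      -- component.
      have huniq : ∀ {x i z}, h x = Sum.inr (i, z) → ∀ {k k'}, x ∈ χ k → x ∈ χ k' →
          r k = r k' := by
        intro x i z hx k k' hk hk'
        have hm : ∀ j, x ∈ χ j → m ≤ j := by
          intro j hj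
          by_contra hlt
          have := hhead x (hQ.root_subset j (not_le.1 hlt) hj)
          rw [hx] at this
          simp at this
        have hi : ∀ j, x ∈ χ j → ω (α j) = i := by
          intro j hj
          obtain ⟨z', hz'⟩ := hentry j x hj
          exact (expand_eq_inr (hz'.symm.trans hx)).1
        obtain ⟨t, -, ht⟩ := exists_top hQ.parent hk
        have hall : ∀ k, x ∈ χ k → r k = r t := by
          intro k
          induction k using Nat.strong_induction_on with
          | _ k ih =>
            intro hk
            by_cases hkt : k = t
            · rw [hkt]
            obtain ⟨hpk, -, hxp⟩ := ht k hk hkt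
            rw [← ih _ hpk hxp]
            exact componentRoot_of_merge
              ⟨hm k hk, hm _ hxp, (hi _ hxp).trans (hi k hk).symm⟩ hpk
        rw [hall k hk, hall k' hk']
      set comp : Var → ℕ := fun x => if hx : ∃ i, x ∈ χ i then r hx.choose else 0 with hcomp
      have hcomp' : ∀ {x i z}, h x = Sum.inr (i, z) → ∀ {k}, x ∈ χ k → comp x = r k := by
        intro x i z hx k hk
        have hex : ∃ i, x ∈ χ i := ⟨k, hk⟩
        rw [hcomp]
        simp only [dif_pos hex]
        exact huniq hx hex.choose_spec hk
      -- Visible variables take their value from ν, private ones from the valuation of their unique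
      -- component.
      refine ⟨fun x => Sum.elim (fun _ => ν (Sum.inl x)) (fun j => ρ (comp x) j.2) (h x),
        fun A hA => ?_, ?_⟩
      · obtain ⟨k, hk, rfl, hχ⟩ := hQ.exists_index A hA
        obtain ⟨-, -, B, hB, hAB⟩ := hω _ hA
        have hrk : r k < n := (hrle k).trans_lt hk
        obtain ⟨hρD, hρz⟩ := hρ (r k) hrk
        rw [hωr k] at hρD hρz
        rw [RelAtom.map_eq_map_of_map_eq_map hAB (g' := ρ (r k))]
        · exact hρD B hB
        · intro x hx z _ hxz
          rw [← hχ] at hx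
          rcases hhx : h x with y | ⟨i, z'⟩
          · rw [hhx] at hxz
            obtain ⟨hz, hzy⟩ := expand_eq_inl hxz.symm
            rw [← hρz z hz, hzy, hσC (x := x) ⟨k, rfl, hx⟩ hhx]
            rfl
          · rw [hhx] at hxz
            obtain ⟨-, rfl⟩ := expand_eq_inr hxz.symm
            simp only [Sum.elim_inr]
            rw [hcomp' hhx hx]
      · rw [RelAtom.map_map]
        exact RelAtom.map_congr fun x hx => by rw [hhead x hx]; rfl
    · rintro F ⟨ν, hν, rfl⟩
      -- τ collapses every copy to the original application inside Q.
      let τ : Var ⊕ ℕ × Var → Var := Sum.elim (fun x => Sum.elim id (fun _ => x) (h x)) Prod.snd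
      have hτ : ∀ c y, τ (σ c y) = y := by
        intro c y
        rcases splitVar_cases h (C c) c y with ⟨x, -, hxy, he⟩ | he
        · simp [τ, σ, he, hxy]
        · simp [τ, σ, he]
      refine ⟨fun Y => ν (τ Y), fun A hA => ?_, ?_⟩
      · obtain ⟨c, -, rfl⟩ := Finset.mem_image.1 hA
        obtain ⟨hV, hμ, -⟩ := hω _ (hQ.atom_mem c)
        refine ⟨_, hV, fun z => ν ((ω (α c)).2 z), fun B hB => hν _ (hμ B hB), ?_⟩
        simp only [W, RelAtom.map_map, hτ]
      · rw [RelAtom.map_map]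
        exact RelAtom.map_congr fun x hx => by simp [τ, hhead x hx]
  -- The bags contain the visible variables of a component; private variables do not occur in the
  -- rewriting.
  set bag : ℕ → Set (Var ⊕ ℕ × Var) := fun i =>
    Sum.inl '' (C (r i) ∩ {x | ∃ y, h x = Sum.inl y})
  have hbagW : ∀ i, bag i ⊆ (W (r i)).vars := by
    rintro i _ ⟨x, ⟨hx, y, hxy⟩, rfl⟩
    exact hcover hx hxy
  have hparent : ∀ i, 0 < i → ∃ q < i, ∀ j < i, bag i ∩ bag j ⊆ bag q := by
    intro i hi
    refine ⟨p i, (hQ.parent i hi).1, fun j hj => ?_⟩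
    rintro _ ⟨⟨x, ⟨hx, hxy⟩, rfl⟩, x', ⟨hx', -⟩, hxx'⟩
    obtain rfl := Sum.inl.inj hxx'
    exact ⟨x', ⟨componentSet_inter_subset hQ.parent hj ⟨hx, hx'⟩, hxy⟩, rfl⟩
  set U := ((List.range m).map bag).reverse with hU
  obtain ⟨L₀, hL₀⟩ : ∃ L₀, ((List.range n).map bag).reverse = L₀ ++ U := by
    obtain ⟨k, rfl⟩ := Nat.exists_eq_add_of_le hQ.le
    rw [List.range_add, List.map_append, List.reverse_append]
    exact ⟨_, rfl⟩
  have hmem₀ : ∀ b, b ∈ L₀ ++ U ↔ ∃ i < n, bag i = b := by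
    intro b
    rw [← hL₀]
    simp
  have hleaf : ∀ c, ∀ x ∈ C c, (∃ y, h x = Sum.inl y) → Sum.inl x ∈ bag c := by
    intro c x hx hxy
    obtain ⟨k, rfl, -⟩ := id hx
    exact ⟨x, ⟨(hrr k).symm ▸ hx, hxy⟩, rfl⟩
  have hrun := runningIntersection_range hparent n
  rw [hL₀] at hrun
  -- Each copy is a leaf at its own bag, since its other variables are tagged with c and occur
  -- nowhere else.
  have hrun' := hrun.append_range (w := fun c => (W c).vars) n fun c hc => by
    refine ⟨bag c, (hmem₀ _).2 ⟨c, hc, rfl⟩, fun s hs => ?_, fun c' hc' => ?_⟩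
    · obtain ⟨j, -, rfl⟩ := (hmem₀ s).1 hs
      rintro Y ⟨hY, x', -, rfl⟩
      rcases hWcases c _ hY with ⟨x, hx, hxy, he⟩ | ⟨y, he⟩
      · rw [he]
        exact hleaf c x hx hxy
      · simp at he
    · rintro Y ⟨hY, hY'⟩
      rcases hWcases c _ hY with ⟨x, hx, hxy, rfl⟩ | ⟨y, rfl⟩
      · exact hleaf c x hx hxy
      · rcases hWcases c' _ hY' with ⟨x, -, -, he⟩ | ⟨y', he⟩
        · simp at he
        · simp only [Sum.inr.injEq, Prod.mk.injEq] at he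
          omega
  rw [← List.append_assoc] at hrun'
  refine ⟨Q₁, _, U, heval, hrun', fun b hb => ?_, fun A hA => ?_, fun b hb => ?_,
    fun hx x hxQ => ?_⟩
  · rw [List.append_assoc] at hb
    rcases List.mem_append.1 hb with hb | hb
    · simp only [List.mem_reverse, List.mem_map, List.mem_range] at hb
      obtain ⟨c, hc, rfl⟩ := hb
      exact ⟨_, hQ₁ c hc, subset_rfl⟩
    · obtain ⟨i, hi, rfl⟩ := (hmem₀ b).1 hb
      exact ⟨_, hQ₁ _ ((hrle i).trans_lt hi), hbagW i⟩
  · obtain ⟨c, hc, rfl⟩ := Finset.mem_image.1 hA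
    refine ⟨(W c).vars, List.mem_append_left _ ?_, subset_rfl⟩
    simp only [List.mem_reverse, List.mem_map]
    exact ⟨c, List.mem_range.2 (Finset.mem_range.1 hc), rfl⟩
  · simp only [hU, List.mem_reverse, List.mem_map, List.mem_range] at hb
    obtain ⟨i, hi, rfl⟩ := hb
    rintro _ ⟨x, ⟨⟨k, hk, hxk⟩, -⟩, rfl⟩
    -- A component with root below m is a single node, so its bag has head variables only.
    have hri : r i < m := (hrle i).trans_lt hi
    have hrk : r k < m := (show r k = r i from hk) ▸ hri
    have hkm : k < m := (hroot k hrk) ▸ hrk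
    change _ ∈ (Q.head.map Sum.inl).vars
    rw [RelAtom.vars_map]
    exact ⟨x, hQ.root_subset k hkm hxk, rfl⟩
  · change x ∈ (Q.head.map Sum.inl).vars at hxQ
    rw [RelAtom.vars_map] at hxQ
    obtain ⟨y, hy, rfl⟩ := hxQ
    obtain ⟨i, hi, hyi⟩ := hx y hy
    refine ⟨bag i, ?_, y, ⟨⟨i, rfl, hyi⟩, y, hhead y hy⟩, rfl⟩
    simp only [hU, List.mem_reverse, List.mem_map, List.mem_range]
    exact ⟨i, hi, rfl⟩

/-! ### Passage to the core and conclusion -/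

/-- A query with a decomposition and a rewriting has a rewriting with a decomposition. -/
theorem IsDecomposition.exists_rewriting [Infinite Var] [Infinite Dom]
    {𝒱 : Set (ConjQuery ar S Var)}
    (h𝒱 : Set.InjOn (fun V : ConjQuery ar S Var => V.head.rel) 𝒱) {Q : ConjQuery ar S Var}
    {L U : List (Set Var × RelAtom ar Var)} (hQ : Q.IsDecomposition L U)
    (hrew : ∃ Q', IsRewriting Dom 𝒱 Q Q') :
    ∃ (Q₂ : ConjQuery ar (viewSchema 𝒱) Var) (L₂ U₂ : List (Set Var)), IsRewriting Dom 𝒱 Q Q₂ ∧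
      RunningIntersection id (L₂ ++ U₂) ∧ (∀ b ∈ L₂ ++ U₂, ∃ A ∈ Q₂.body, b ⊆ A.vars) ∧
      (∀ A ∈ Q₂.body, ∃ b ∈ L₂, A.vars ⊆ b) ∧ (∀ b ∈ U₂, b ⊆ Q₂.head.vars) ∧
      ((∀ x ∈ Q.head.vars, ∃ b ∈ U, x ∈ b.1) → ∀ x ∈ Q₂.head.vars, ∃ b ∈ U₂, x ∈ b) := by
  obtain ⟨Q', hQ'⟩ := hrew
  obtain ⟨Q₀, hhead, hbody, ⟨e, he, hfix⟩, hcore⟩ := Q.exists_core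
  have heval : ∀ D : Set (RelAtom ar Dom), Q₀.eval D = Q.eval D := fun D =>
    Set.Subset.antisymm
      (eval_subset_of_hom e he (by
        rw [← hhead]
        exact RelAtom.map_eq_self fun x hx => hfix x (Q₀.safe x hx)) D)
      (eval_subset_of_hom id (fun A hA => hbody hA) hhead D)
  have hQ₀ : IsRewriting Dom 𝒱 Q₀ Q' := fun D hD => (hQ' D hD).trans (heval D).symm
  obtain ⟨hrel, ω, h, hinj, hh, hω⟩ := hQ₀.exists_hom hcore
  obtain ⟨n, m, χ, α, p, hind, hU⟩ := (hQ.retract hhead hbody he hfix).exists_indexed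
  obtain ⟨Q₁, L₁, U₁, h₁, hrun, hbag, hatom, hroot, hconn⟩ :=
    hind.exists_rewriting (Dom := Dom) h𝒱 hrel hinj hh hω
  obtain ⟨φ, Q₂, hφ, hφhead, hφbody, hφeval⟩ := Q₁.exists_rename (Var := Var) (Dom := Dom)
  refine ⟨Q₂, L₁.map (φ '' ·), U₁.map (φ '' ·), fun D hD => ?_, ?_, ?_, ?_, ?_, ?_⟩
  · rw [hφeval, h₁, heval]
  · rw [← List.map_append]
    refine hrun.image hφ fun b hb x hx => ?_
    obtain ⟨A, hA, hbA⟩ := hbag b hb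
    exact ⟨A, hA, hbA hx⟩
  · rw [← List.map_append]
    intro b hb
    obtain ⟨c, hc, rfl⟩ := List.mem_map.1 hb
    obtain ⟨A, hA, hcA⟩ := hbag c hc
    refine ⟨_, (hφbody _).2 ⟨A, hA, rfl⟩, ?_⟩
    rw [RelAtom.vars_map]
    exact Set.image_mono hcA
  · intro A hA
    obtain ⟨B, hB, rfl⟩ := (hφbody A).1 hA
    obtain ⟨b, hb, hBb⟩ := hatom B hB
    refine ⟨_, List.mem_map_of_mem hb, ?_⟩
    rw [RelAtom.vars_map]
    exact Set.image_mono hBb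
  · intro b hb
    obtain ⟨c, hc, rfl⟩ := List.mem_map.1 hb
    rw [hφhead, RelAtom.vars_map]
    exact Set.image_mono (hroot c hc)
  · intro hx x hxQ
    rw [hφhead, RelAtom.vars_map] at hxQ
    obtain ⟨y, hy, rfl⟩ := hxQ
    obtain ⟨b, hb, hyb⟩ := hconn (fun x hxh => by
      rw [hhead] at hxh
      obtain ⟨b, hb, hxb⟩ := hx x hxh
      obtain ⟨i, hi, hib⟩ := hU _ (List.mem_map_of_mem hb)
      exact ⟨i, hi, hib ▸ ⟨hxb, Q₀.safe x (hhead ▸ hxh)⟩⟩) y hy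
    exact ⟨_, List.mem_map_of_mem hb, y, hyb, rfl⟩

end ConjQuery

theorem mainTheorem1 {R Var Dom : Type*} [Infinite Var] [Infinite Dom] {ar : R → ℕ} {S : Set R}
    (Q : ConjQuery ar S Var) (𝒱 : Set (ConjQuery ar S Var))
    (h𝒱 : Set.InjOn (fun V : ConjQuery ar S Var => V.head.rel) 𝒱) :
    (Q.Acyclic → (∃ Q', ConjQuery.IsRewriting Dom 𝒱 Q Q') →
      ∃ Q', ConjQuery.IsRewriting Dom 𝒱 Q Q' ∧ Q'.Acyclic) ∧
    (Q.FreeConnexAcyclic → (∃ Q', ConjQuery.IsRewriting Dom 𝒱 Q Q') →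
      ∃ Q', ConjQuery.IsRewriting Dom 𝒱 Q Q' ∧ Q'.FreeConnexAcyclic) := by
  constructor
  · intro hQ hrew
    obtain ⟨L, hL⟩ := hQ.exists_isDecomposition
    obtain ⟨Q₂, L₂, U₂, h₂, hrun, hbag, hatom, -, -⟩ := hL.exists_rewriting h𝒱 hrew
    refine ⟨Q₂, h₂, ConjQuery.acyclic_of_runningIntersection hrun hbag fun A hA => ?_⟩
    obtain ⟨b, hb, hAb⟩ := hatom A hA
    exact ⟨b, List.mem_append_left _ hb, hAb⟩
  · intro hQ hrew
    obtain ⟨L, U, hL, hU⟩ := hQ.exists_isDecomposition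
    obtain ⟨Q₂, L₂, U₂, h₂, hrun, hbag, hatom, hroot, hconn⟩ := hL.exists_rewriting h𝒱 hrew
    exact ⟨Q₂, h₂, ConjQuery.freeConnexAcyclic_of_runningIntersection hrun hbag hatom
      fun x => ⟨hconn hU x, fun ⟨b, hb, hx⟩ => hroot b hb hx⟩⟩
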